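/- **Definitions.** An *increasing tree* of size $n\ge 1$ is a planar rooted tree with $n$ nodes labeled $1,2,\dots,n$ (each label used once), with root labeled $1$, in which each node has at most one left child and at most one right child, and the label of each node is smaller than the labels of its children. The *rightmost node* is the node reached from the root by following right children as long as possible. An increasing tree of size $n$ is *complete* if every node is either a leaf or has two children, except that, when $n$ is even, the rightmost node has a left child but no right child. Let $\mathfrak T_n$ be the set of complete increasing trees of size $n$. For $t\in\mathfrak T_n$, let $\mathrm{eoc}(t)$ ("end of the minimal chain") be the label of the leaf reached from the root by moving, from each interior node, to its child of smaller label (its only child if it has just one). For $n\ge 2$ let $\mathrm{pom}(t)$ be the label of the parent of the leaf labeled $n$. For $2\le m\le 2n$ and $1\le k\le 2n-1$, where $n\ge1$, put $$f_{2n}(m,k)=\#\{t\in\mathfrak T_{2n}:\ \mathrm{eoc}(t)=m,\ \mathrm{pom}(t)=k\},$$ $$f_{2n}(m,\bullet)=\sum_{k=1}^{2n-1}f_{2n}(m,k),\qquad f_{2n}(\bullet,k)=\sum_{m=2}^{2n}f_{2n}(m,k).$$ **Theorem 1.2.** Let $n\ge 2$. Then 1. (first top row) $f_{2n}(2,k)=f_{2n-2}(\bullet,k-2)=f_{2n-2}(k-1,\bullet)$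 for $3\le k\le 2n-1$; 2. (second top row) $f_{2n}(3,k)=3f_{2n}(2,k)$ for $4\le k\le 2n-1$; 3. (rightmost column) $f_{2n}(m,2n-1)=f_{2n-2}(m,\bullet)=f_{2n-2}(\bullet,m-1)$ for $2\le m\le 2n-2$; 4. (next to rightmost column) $f_{2n}(m,2n-2)=3f_{2n}(m,2n-1)$ for $2\le m\le 2n-3$. -/

import Mathlib

namespace SecantTree

/-! Labeled planar binary trees are values of Mathlib's `BinaryTree ℕ`: `nil` is the empty subtree
(no child), and `node a l r` is a node labeled `a` with left subtree `l` and right subtree `r`.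
A leaf is `node a nil nil`. -/

/-- The label of the root, if the tree is non-empty. -/
def rootLabel? : BinaryTree ℕ → Option ℕ
  | .nil => none
  | .node a _ _ => some a

/-- The labels of a tree read from left to right (the projection of the nodes on a horizontal
axis). -/
def labels : BinaryTree ℕ → List ℕ
  | .nil => []
  | .node a l r => labels l ++ a :: labels r

/-- The label of each node is smaller than the labels of its children, if any. -/
def Increasing : BinaryTree ℕ → Prop
  | .nil => True
  | .node a l r =>
      (∀ b ∈ rootLabel? l, a < b) ∧ (∀ c ∈ rootLabel? r, a < c) ∧ Increasing l ∧ Increasing r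

/-- Every node is either a leaf or a node with two children. -/
def EveryNodeFull : BinaryTree ℕ → Prop
  | .nil => True
  | .node _ l r => (l = .nil ↔ r = .nil) ∧ EveryNodeFull l ∧ EveryNodeFull r

/-- The rightmost node (the one reached from the root by following right children as long as
possible) has a left child but no right child, and every other node is either a leaf or a node with
two children. -/
def FullExceptRightmost : BinaryTree ℕ → Prop
  | .nil => False
  | .node _ l r =>
      l ≠ .nil ∧ EveryNodeFull l ∧ (r = .nil ∨ FullExceptRightmost r)

/-- `t` is an increasing tree of size `n`: its nodes are labeled `1, 2, …, n` (each label being used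
once), the root is labeled `1`, and labels increase from parent to child. -/
def IsIncreasingTree (n : ℕ) (t : BinaryTree ℕ) : Prop :=
  (labels t).Perm (List.range' 1 n) ∧ rootLabel? t = some 1 ∧ Increasing t

/-- `t` is a complete increasing tree of size `n`: an increasing tree of size `n` in which every
node is a leaf or has two children, except that, when `n` is even, the rightmost node has a left
child and no right child. For even `n` these are the secant trees. -/
def IsCompleteIncreasing (n : ℕ) (t : BinaryTree ℕ) : Prop :=
  IsIncreasingTree n t ∧ if Even n then FullExceptRightmost t else EveryNodeFull t

/-- The end of the minimal chain: starting from the root, move from each interior node to its child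
of smaller label (to its only child if there is just one) until a leaf is reached. The value on the
empty tree is irrelevant. -/
def eoc : BinaryTree ℕ → ℕ
  | .nil => 0
  | .node a l r =>
      match rootLabel? l, rootLabel? r with
      | none, none => a
      | some _, none => eoc l
      | none, some _ => eoc r
      | some b, some c => if b < c then eoc l else eoc r

/-- The label of the parent of the node labeled `x`, if there is one. -/
def parent? (x : ℕ) : BinaryTree ℕ → Option ℕ
  | .nil => none
  | .node a l r =>
      if rootLabel? l = some x ∨ rootLabel? r = some x then some a
      else (parent? x l).or (parent? x r)

/-- The label of the parent of the maximum leaf of a tree of size `n`, that is, of the node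
labeled `n`. It is `none` only if that node has no parent (which does not happen in an increasing
tree of size `n ≥ 2`). -/
def pom? (n : ℕ) (t : BinaryTree ℕ) : Option ℕ := parent? n t

/-- The number `f_n(m,k)` of complete increasing trees `t` of size `n` with `eoc(t) = m` and
`pom(t) = k`. -/
noncomputable def f (n m k : ℕ) : ℕ :=
  {t : BinaryTree ℕ | IsCompleteIncreasing n t ∧ eoc t = m ∧ pom? n t = some k}.ncard

/-- The row sum `f_n(m,•)` over all columns `1 ≤ k ≤ n - 1`. -/
noncomputable def rowSum (n m : ℕ) : ℕ := ∑ k ∈ Finset.Icc 1 (n - 1), f n m k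

/-- The column sum `f_n(•,k)` over all rows `2 ≤ m ≤ n`. -/
noncomputable def colSum (n k : ℕ) : ℕ := ∑ m ∈ Finset.Icc 2 n, f n m k

/-- There are finitely many complete increasing trees of size `n`, so that `f` is an honest
count. -/
theorem finite_completeIncreasing (n : ℕ) :
    {t : BinaryTree ℕ | IsCompleteIncreasing n t}.Finite := by
  have key : ∀ h : ℕ, {t : BinaryTree ℕ | t.height ≤ h ∧ ∀ x ∈ labels t, x ≤ n}.Finite := by
    intro h
    induction h with
    | zero =>
      refine (Set.finite_singleton (BinaryTree.nil : BinaryTree ℕ)).subset ?_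
      rintro (_ | ⟨a, l, r⟩) ht
      · rfl
      · simp at ht
    | succ h ih =>
      refine ((Set.finite_singleton (BinaryTree.nil : BinaryTree ℕ)).union
        (((Set.finite_Iic n).prod (ih.prod ih)).image
          (fun p => BinaryTree.node p.1 p.2.1 p.2.2))).subset ?_
      rintro (_ | ⟨a, l, r⟩) ⟨hh, ht⟩
      · exact Or.inl rfl
      · simp only [BinaryTree.height, add_le_add_iff_right, max_le_iff] at hh
        simp only [labels, List.mem_append, List.mem_cons] at ht
        exact Or.inr ⟨(a, l, r), ⟨ht a (Or.inr (Or.inl rfl)),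
          ⟨hh.1, fun x hx => ht x (Or.inl hx)⟩,
          ⟨hh.2, fun x hx => ht x (Or.inr (Or.inr hx))⟩⟩, rfl⟩
  have hlen : ∀ t : BinaryTree ℕ, (labels t).length = t.numNodes := by
    intro t
    induction t with
    | nil => rfl
    | node a l r hl hr => simp only [labels, List.length_append, List.length_cons, hl, hr,
        BinaryTree.numNodes]; omega
  refine (key n).subset ?_
  rintro t ⟨⟨hp, -, -⟩, -⟩
  refine ⟨?_, fun x hx => ?_⟩
  · have := hp.length_eq
    rw [hlen, List.length_range'] at this
    exact this ▸ t.height_le_numNodes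
  · have := hp.mem_iff.1 hx
    rw [List.mem_range'_1] at this
    omega

end SecantTree

/-! Put `M = 2n - 2`. Every identity comes from a correspondence between trees with `M` and with
`M + 2` nodes.

* Shifting the labels one step up along the minimal chain discards the root label and frees the end
  of the chain for a new maximal label, whose parent then carries the old `eoc`. Hence `eoc` and
  `pom + 1` are equidistributed.
* If `eoc = 2`, then the left child of the root is the leaf `2`, and the right subtree of the root
  is an arbitrary tree on the labels `3, …, M + 2`.
* If `eoc = 3`, then removing the nodes `1` and `2` and joining the two remaining subtrees below `3`
  gives such a tree as well, and each one arises in exactly three ways.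
* If the parent `k` of the maximal leaf is among the three largest labels, then the subtree at `k`
  contains only `k`, the maximal leaf and at most one more leaf. If `k` has one child, it is the
  rightmost node, and deleting it with its child leaves a tree with `M` nodes. If `k = M` has two
  children, they are the leaves `M + 1` and `M + 2` in either order, and deleting them does. -/

namespace SecantTree

/-- The tree with a single node. -/
abbrev leaf (a : ℕ) : BinaryTree ℕ := .node a .nil .nil

/-- The multiset of the labels of a tree, that is, `labels` up to the order of the nodes. -/
def content (t : BinaryTree ℕ) : Multiset ℕ := labels t

section Basic

variable {a b c x : ℕ} {l r t : BinaryTree ℕ}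

@[simp]
theorem content_nil : content .nil = 0 := rfl

@[simp]
theorem content_node : content (.node a l r) = a ::ₘ (content l + content r) := by
  simp [content, labels]

theorem mem_content_node : x ∈ content (.node a l r) ↔ x = a ∨ x ∈ content l ∨ x ∈ content r := by
  simp

theorem nodup_content_node :
    (content (.node a l r)).Nodup ↔
      a ∉ content l ∧ a ∉ content r ∧ (content l).Nodup ∧ (content r).Nodup ∧
        Disjoint (content l) (content r) := by
  simp [Multiset.nodup_add, and_assoc]

@[simp]
theorem rootLabel?_nil : rootLabel? .nil = none := rfl

@[simp]
theorem rootLabel?_node : rootLabel? (.node a l r) = some a := rfl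

theorem rootLabel?_eq_none : rootLabel? t = none ↔ t = .nil := by
  cases t <;> simp

theorem rootLabel?_eq_some : rootLabel? t = some a ↔ ∃ l r, t = .node a l r := by
  cases t <;> simp [eq_comm]

theorem exists_rootLabel?_eq_some (ht : t ≠ .nil) : ∃ a, rootLabel? t = some a :=
  Option.ne_none_iff_exists'.1 (mt rootLabel?_eq_none.1 ht)

theorem mem_content_of_rootLabel? (h : rootLabel? t = some a) : a ∈ content t := by
  obtain ⟨l, r, rfl⟩ := rootLabel?_eq_some.1 h
  simp

theorem rootLabel?_ne_some (h : a ∉ content t) : rootLabel? t ≠ some a :=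
  mt mem_content_of_rootLabel? h

theorem Increasing.le_of_mem (ht : Increasing t) (ha : rootLabel? t = some a)
    (hb : b ∈ content t) : a ≤ b := by
  induction t generalizing a with
  | nil => simp at hb
  | node a' l r ihl ihr =>
    obtain ⟨hal, har, hl, hr⟩ := ht
    obtain rfl : a' = a := by simpa using ha
    have lt_of_mem {s : BinaryTree ℕ} (has : ∀ d ∈ rootLabel? s, a' < d)
        (ih : ∀ {d}, rootLabel? s = some d → b ∈ content s → d ≤ b) (hbs : b ∈ content s) :
        a' ≤ b := by
      cases s with
      | nil => simp at hbs
      | node d _ _ => exact (has d rfl).le.trans (ih rfl hbs)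
    simp only [mem_content_node] at hb
    rcases hb with rfl | hb | hb
    · rfl
    · exact lt_of_mem hal (ihl hl) hb
    · exact lt_of_mem har (ihr hr) hb

theorem Increasing.forall_lt_rootLabel? (ht : Increasing t) :
    (∀ b ∈ rootLabel? t, a < b) ↔ ∀ b ∈ content t, a < b := by
  refine ⟨fun h b hb => ?_, fun h b hb => h b (mem_content_of_rootLabel? hb)⟩
  cases t with
  | nil => simp at hb
  | node c l r => exact (h c rfl).trans_le (ht.le_of_mem rfl hb)

theorem increasing_node :
    Increasing (.node a l r) ↔
      (∀ b ∈ content l, a < b) ∧ (∀ c ∈ content r, a < c) ∧ Increasing l ∧ Increasing r := by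
  refine ⟨fun ⟨hal, har, hl, hr⟩ => ?_, fun ⟨hal, har, hl, hr⟩ => ?_⟩
  · exact ⟨hl.forall_lt_rootLabel?.1 hal, hr.forall_lt_rootLabel?.1 har, hl, hr⟩
  · exact ⟨hl.forall_lt_rootLabel?.2 hal, hr.forall_lt_rootLabel?.2 har, hl, hr⟩

theorem FullExceptRightmost.ne_nil (ht : FullExceptRightmost t) : t ≠ .nil := by
  rintro rfl
  exact ht

theorem FullExceptRightmost.not_everyNodeFull (ht : FullExceptRightmost t) :
    ¬EveryNodeFull t := by
  induction t with
  | nil => exact ht.elim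
  | node a l r _ ihr =>
    obtain ⟨hl, -, rfl | hr⟩ := ht
    · exact fun h => hl (h.1.2 rfl)
    · exact fun h => ihr hr h.2.2

theorem parent?_eq_none (hx : x ∉ content t) : parent? x t = none := by
  induction t with
  | nil => rfl
  | node a l r ihl ihr =>
    simp only [mem_content_node, not_or] at hx
    simp [parent?, rootLabel?_ne_some hx.2.1, rootLabel?_ne_some hx.2.2, ihl hx.2.1, ihr hx.2.2]

theorem parent?_node_of_notMem_left (hl : x ∉ content l) (hr : rootLabel? r ≠ some x) :
    parent? x (.node a l r) = parent? x r := by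
  simp [parent?, rootLabel?_ne_some hl, hr, parent?_eq_none hl]

theorem parent?_node_of_notMem_right (hl : rootLabel? l ≠ some x) (hr : x ∉ content r) :
    parent? x (.node a l r) = parent? x l := by
  simp [parent?, rootLabel?_ne_some hr, hl, parent?_eq_none hr]

theorem isSome_parent? (hx : x ∈ content t) (hroot : rootLabel? t ≠ some x) :
    (parent? x t).isSome := by
  induction t with
  | nil => simp at hx
  | node a l r ihl ihr =>
    rw [parent?]
    split_ifs with h
    · rfl
    · obtain ⟨hl, hr⟩ := not_or.1 h
      have hxa : x ≠ a := fun e => hroot (by rw [e, rootLabel?_node])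
      simp only [mem_content_node, hxa, false_or] at hx
      rw [Option.isSome_or, Bool.or_eq_true]
      exact hx.imp (ihl · hl) (ihr · hr)

end Basic

/-! ### One-hole contexts -/

/-- A tree in which one subtree has been replaced by a hole. -/
inductive TreeContext
  | hole
  | left (a : ℕ) (C : TreeContext) (r : BinaryTree ℕ)
  | right (a : ℕ) (l : BinaryTree ℕ) (C : TreeContext)

namespace TreeContext

/-- The tree obtained by putting `s` into the hole. -/
def fill (s : BinaryTree ℕ) : TreeContext → BinaryTree ℕ
  | hole => s
  | left a C r => .node a (C.fill s) r
  | right a l C => .node a l (C.fill s)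

/-- The multiset of the labels outside the hole. -/
def content : TreeContext → Multiset ℕ
  | hole => 0
  | left a C r => a ::ₘ (C.content + SecantTree.content r)
  | right a l C => a ::ₘ (SecantTree.content l + C.content)

variable {C C' : TreeContext} {k x : ℕ} {s s' t : BinaryTree ℕ}

theorem content_fill : SecantTree.content (C.fill s) = C.content + SecantTree.content s := by
  induction C with
  | hole => simp [fill, content]
  | left a C r ih => simp [fill, content, ih, add_right_comm]
  | right a l C ih => simp [fill, content, ih, add_assoc]

theorem rootLabel?_fill_congr (h : rootLabel? s = rootLabel? s') :
    rootLabel? (C.fill s) = rootLabel? (C.fill s') := by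
  cases C with
  | hole => exact h
  | left a C r => rfl
  | right a l C => rfl

theorem fill_eq_nil_congr (h : rootLabel? s = rootLabel? s') :
    C.fill s = .nil ↔ C.fill s' = .nil := by
  rw [← rootLabel?_eq_none, rootLabel?_fill_congr h, rootLabel?_eq_none]

theorem increasing_fill_congr (hroot : rootLabel? s = rootLabel? s')
    (h : Increasing s ↔ Increasing s') : Increasing (C.fill s) ↔ Increasing (C.fill s') := by
  induction C with
  | hole => exact h
  | left a C r ih => simp [fill, Increasing, rootLabel?_fill_congr hroot, ih]
  | right a l C ih => simp [fill, Increasing, rootLabel?_fill_congr hroot, ih]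

theorem everyNodeFull_fill_congr (hroot : rootLabel? s = rootLabel? s')
    (h : EveryNodeFull s ↔ EveryNodeFull s') :
    EveryNodeFull (C.fill s) ↔ EveryNodeFull (C.fill s') := by
  induction C with
  | hole => exact h
  | left a C r ih => simp [fill, EveryNodeFull, fill_eq_nil_congr hroot, ih]
  | right a l C ih => simp [fill, EveryNodeFull, fill_eq_nil_congr hroot, ih]

theorem fullExceptRightmost_fill_congr (hroot : rootLabel? s = rootLabel? s')
    (hfull : EveryNodeFull s ↔ EveryNodeFull s')
    (h : FullExceptRightmost s ↔ FullExceptRightmost s') :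
    FullExceptRightmost (C.fill s) ↔ FullExceptRightmost (C.fill s') := by
  induction C with
  | hole => exact h
  | left a C r _ =>
    simp [fill, FullExceptRightmost, fill_eq_nil_congr hroot,
      everyNodeFull_fill_congr hroot hfull]
  | right a l C ih => simp [fill, FullExceptRightmost, fill_eq_nil_congr hroot, ih]

theorem increasing_of_fill (h : Increasing (C.fill s)) : Increasing s := by
  induction C with
  | hole => exact h
  | left a C r ih => exact ih h.2.2.1
  | right a l C ih => exact ih h.2.2.2

theorem everyNodeFull_of_fill (h : EveryNodeFull (C.fill s)) : EveryNodeFull s := by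
  induction C with
  | hole => exact h
  | left a C r ih => exact ih h.2.1
  | right a l C ih => exact ih h.2.2

theorem everyNodeFull_or_fullExceptRightmost_of_fill (h : FullExceptRightmost (C.fill s)) :
    EveryNodeFull s ∨ FullExceptRightmost s := by
  induction C with
  | hole => exact .inr h
  | left a C r _ => exact .inl (everyNodeFull_of_fill h.2.1)
  | right a l C ih =>
    rcases h.2.2 with hnil | hfull
    · have hs : s = .nil := by
        cases C <;> simp_all [fill]
      exact .inl (hs ▸ trivial)
    · exact ih hfull

theorem rootLabel?_fill_ne (hx : x ∉ C.content) (hs : rootLabel? s ≠ some x) :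
    rootLabel? (C.fill s) ≠ some x := by
  cases C with
  | hole => exact hs
  | left a C r => simp_all [fill, content, eq_comm]
  | right a l C => simp_all [fill, content, eq_comm]

theorem parent?_fill (hx : x ∉ C.content) (hs : rootLabel? s ≠ some x) :
    parent? x (C.fill s) = parent? x s := by
  induction C with
  | hole => rfl
  | left a C r ih =>
    simp only [content, Multiset.mem_cons, Multiset.mem_add, not_or] at hx
    rw [fill, parent?_node_of_notMem_right (rootLabel?_fill_ne hx.2.1 hs) hx.2.2, ih hx.2.1]
  | right a l C ih =>
    simp only [content, Multiset.mem_cons, Multiset.mem_add, not_or] at hx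
    rw [fill, parent?_node_of_notMem_left hx.2.1 (rootLabel?_fill_ne hx.2.2 hs), ih hx.2.2]

theorem exists_fill_of_parent? (h : parent? x t = some k) :
    ∃ (C : TreeContext) (l r : BinaryTree ℕ), t = C.fill (.node k l r) ∧
      (rootLabel? l = some x ∨ rootLabel? r = some x) := by
  induction t with
  | nil => simp [parent?] at h
  | node a l r ihl ihr =>
    rw [parent?] at h
    split_ifs at h with hx
    · exact ⟨hole, l, r, by simpa [fill] using h, hx⟩
    · rcases Option.or_eq_some_iff.1 h with h | ⟨-, h⟩
      · obtain ⟨C, l', r', rfl, hx'⟩ := ihl h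
        exact ⟨left a C r, l', r', rfl, hx'⟩
      · obtain ⟨C, l', r', rfl, hx'⟩ := ihr h
        exact ⟨right a l C, l', r', rfl, hx'⟩

theorem exists_fill_of_mem_content (h : k ∈ SecantTree.content t) :
    ∃ (C : TreeContext) (l r : BinaryTree ℕ), t = C.fill (.node k l r) := by
  induction t with
  | nil => simp at h
  | node a l r ihl ihr =>
    rcases mem_content_node.1 h with rfl | h | h
    · exact ⟨hole, l, r, rfl⟩
    · obtain ⟨C, l', r', rfl⟩ := ihl h
      exact ⟨left a C r, l', r', rfl⟩
    · obtain ⟨C, l', r', rfl⟩ := ihr h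
      exact ⟨right a l C, l', r', rfl⟩

theorem mem_content_fill_of_rootLabel? (hs : rootLabel? s = some x) :
    x ∈ SecantTree.content (C.fill s) := by
  rw [content_fill, Multiset.mem_add]
  exact .inr (mem_content_of_rootLabel? hs)

theorem fill_inj (hs : rootLabel? s = some x) (hs' : rootLabel? s' = some x)
    (hC : x ∉ C.content) (hC' : x ∉ C'.content) (h : C.fill s = C'.fill s') :
    C = C' ∧ s = s' := by
  have hmem {C : TreeContext} {s : BinaryTree ℕ} : rootLabel? s = some x →
      x ∈ SecantTree.content (C.fill s) := mem_content_fill_of_rootLabel?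
  induction C generalizing C' with
  | hole =>
    obtain rfl : s = C'.fill s' := h
    cases C' <;> simp_all [fill, content]
  | left a C r ih =>
    simp only [content, Multiset.mem_cons, Multiset.mem_add, not_or] at hC
    cases C' with
    | hole =>
      obtain rfl : _ = s' := h
      exact absurd hs' (by simpa [fill, eq_comm] using hC.1)
    | left a' C' r' =>
      simp only [content, Multiset.mem_cons, Multiset.mem_add, not_or] at hC'
      obtain ⟨rfl, hfill, rfl⟩ := BinaryTree.node.inj h
      obtain ⟨rfl, rfl⟩ := ih hC.2.1 hC'.2.1 hfill
      exact ⟨rfl, rfl⟩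
    | right a' l' C' => exact absurd ((BinaryTree.node.inj h).2.2 ▸ hmem hs') hC.2.2
  | right a l C ih =>
    simp only [content, Multiset.mem_cons, Multiset.mem_add, not_or] at hC
    cases C' with
    | hole =>
      obtain rfl : _ = s' := h
      exact absurd hs' (by simpa [fill, eq_comm] using hC.1)
    | left a' C' r' => exact absurd ((BinaryTree.node.inj h).2.1 ▸ hmem hs') hC.2.1
    | right a' l' C' =>
      simp only [content, Multiset.mem_cons, Multiset.mem_add, not_or] at hC'
      obtain ⟨rfl, rfl, hfill⟩ := BinaryTree.node.inj h
      obtain ⟨rfl, rfl⟩ := ih hC.2.2 hC'.2.2 hfill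
      exact ⟨rfl, rfl⟩

end TreeContext

/-! ### The minimal chain -/

section MinimalChain

variable {a b c x y : ℕ} {l r t : BinaryTree ℕ}

@[simp]
theorem eoc_leaf : eoc (leaf a) = a := rfl

theorem eoc_node_left (hl : rootLabel? l = some b) (hr : ∀ c ∈ rootLabel? r, b < c) :
    eoc (.node a l r) = eoc l := by
  cases h : rootLabel? r with
  | none => simp [eoc, hl, h]
  | some c => simp [eoc, hl, h, hr c h]

theorem eoc_node_right (hl : ∀ b ∈ rootLabel? l, c ≤ b) (hr : rootLabel? r = some c) :
    eoc (.node a l r) = eoc r := by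
  cases h : rootLabel? l with
  | none => simp [eoc, h, hr]
  | some b => simp [eoc, h, hr, (hl b h).not_gt]

theorem minimalChain_cases (l r : BinaryTree ℕ) :
    (l = .nil ∧ r = .nil) ∨ (∃ b, rootLabel? l = some b ∧ ∀ c ∈ rootLabel? r, b < c) ∨
      ∃ c, (∀ b ∈ rootLabel? l, c ≤ b) ∧ rootLabel? r = some c := by
  cases l with
  | nil => cases r <;> simp
  | node b _ _ =>
    cases r with
    | nil => simp
    | node c _ _ => simpa using lt_or_ge b c

@[elab_as_elim]
theorem minimalChain_induction {P : BinaryTree ℕ → Prop} (nil : P .nil) (leaf : ∀ a, P (leaf a))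
    (left : ∀ a b l r, rootLabel? l = some b → (∀ c ∈ rootLabel? r, b < c) → P l →
      P (.node a l r))
    (right : ∀ a c l r, (∀ b ∈ rootLabel? l, c ≤ b) → rootLabel? r = some c → P r →
      P (.node a l r))
    (t : BinaryTree ℕ) : P t := by
  induction t with
  | nil => exact nil
  | node a l r ihl ihr =>
    rcases minimalChain_cases l r with ⟨rfl, rfl⟩ | ⟨b, hl, hr⟩ | ⟨c, hl, hr⟩
    · exact leaf a
    · exact left a b l r hl hr ihl
    · exact right a c l r hl hr ihr

theorem ne_nil_of_rootLabel? (h : rootLabel? t = some a) : t ≠ .nil := by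
  rintro rfl
  simp at h

theorem eoc_mem (ht : t ≠ .nil) : eoc t ∈ content t := by
  induction t using minimalChain_induction with
  | nil => exact absurd rfl ht
  | leaf a => simp
  | left a b l r hl hr ih => simp [eoc_node_left hl hr, ih (ne_nil_of_rootLabel? hl)]
  | right a c l r hl hr ih => simp [eoc_node_right hl hr, ih (ne_nil_of_rootLabel? hr)]

/-- Deletes the root label, moves every other label of the minimal chain one step towards the root,
and puts `x` at the end of the chain, as in Schützenberger's promotion. -/
def slide (x : ℕ) : BinaryTree ℕ → BinaryTree ℕ
  | .nil => .nil
  | .node _ l r =>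
      match rootLabel? l, rootLabel? r with
      | none, none => leaf x
      | some b, none => .node b (slide x l) r
      | none, some c => .node c l (slide x r)
      | some b, some c => if b < c then .node b (slide x l) r else .node c l (slide x r)

/-- Undoes `slide x` when `y` is the deleted root label: the labels on the path from the root to
`x` move one step away from the root, and `y` becomes the label of the root. -/
def unslide (x y : ℕ) : BinaryTree ℕ → BinaryTree ℕ
  | .nil => .nil
  | .node a l r =>
      if x ∈ content l then .node y (unslide x a l) r
      else if x ∈ content r then .node y l (unslide x a r)
      else .node y l r

theorem slide_leaf : slide x (leaf a) = leaf x := rfl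

theorem slide_node_left (hl : rootLabel? l = some b) (hr : ∀ c ∈ rootLabel? r, b < c) :
    slide x (.node a l r) = .node b (slide x l) r := by
  cases h : rootLabel? r with
  | none => simp [slide, hl, h]
  | some c => simp [slide, hl, h, hr c h]

theorem slide_node_right (hl : ∀ b ∈ rootLabel? l, c ≤ b) (hr : rootLabel? r = some c) :
    slide x (.node a l r) = .node c l (slide x r) := by
  cases h : rootLabel? l with
  | none => simp [slide, h, hr]
  | some b => simp [slide, h, hr, (hl b h).not_gt]

theorem slide_eq_nil : slide x t = .nil ↔ t = .nil := by
  induction t using minimalChain_induction with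
  | nil => rfl
  | leaf a => simp [slide_leaf]
  | left a b l r hl hr _ => simp [slide_node_left hl hr]
  | right a c l r hl hr _ => simp [slide_node_right hl hr]

theorem everyNodeFull_slide : EveryNodeFull (slide x t) ↔ EveryNodeFull t := by
  induction t using minimalChain_induction with
  | nil => rfl
  | leaf a => rfl
  | left a b l r hl hr ih => simp [slide_node_left hl hr, EveryNodeFull, ih, slide_eq_nil]
  | right a c l r hl hr ih => simp [slide_node_right hl hr, EveryNodeFull, ih, slide_eq_nil]

theorem fullExceptRightmost_slide : FullExceptRightmost (slide x t) ↔ FullExceptRightmost t := by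
  induction t using minimalChain_induction with
  | nil => rfl
  | leaf a => rfl
  | left a b l r hl hr _ =>
    simp [slide_node_left hl hr, FullExceptRightmost, everyNodeFull_slide, slide_eq_nil]
  | right a c l r hl hr ih =>
    simp [slide_node_right hl hr, FullExceptRightmost, ih, slide_eq_nil]

theorem cons_content_slide (ha : rootLabel? t = some a) :
    a ::ₘ content (slide x t) = x ::ₘ content t := by
  induction t using minimalChain_induction generalizing a with
  | nil => simp at ha
  | leaf a' =>
    obtain rfl : a' = a := by simpa using ha
    exact Multiset.cons_swap a' x 0
  | left a' b l r hl hr ih =>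
    obtain rfl : a' = a := by simpa using ha
    rw [slide_node_left hl hr, content_node, content_node, ← Multiset.cons_add, ih hl,
      Multiset.cons_add, Multiset.cons_swap]
  | right a' c l r hl hr ih =>
    obtain rfl : a' = a := by simpa using ha
    rw [slide_node_right hl hr, content_node, content_node, ← Multiset.add_cons, ih hr,
      Multiset.add_cons, Multiset.cons_swap]

theorem mem_content_slide (ht : t ≠ .nil) (hx : x ∉ content t) : x ∈ content (slide x t) := by
  obtain ⟨a, ha⟩ := exists_rootLabel?_eq_some ht
  have hmem : x ∈ a ::ₘ content (slide x t) := by simp [cons_content_slide ha]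
  refine (Multiset.mem_cons.1 hmem).resolve_left fun h => hx ?_
  exact h ▸ mem_content_of_rootLabel? ha

theorem Increasing.lt_rootLabel?_slide (ht : Increasing t) (ha : rootLabel? t = some a)
    (hax : a < x) : ∀ b ∈ rootLabel? (slide x t), a < b := by
  induction t using minimalChain_induction with
  | nil => simp at ha
  | leaf a' => simpa [slide_leaf] using hax
  | left a' b l r hl hr _ =>
    obtain rfl : a' = a := by simpa using ha
    simpa [slide_node_left hl hr] using ht.1 b hl
  | right a' c l r hl hr _ =>
    obtain rfl : a' = a := by simpa using ha
    simpa [slide_node_right hl hr] using ht.2.1 c hr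

theorem Increasing.slide (ht : Increasing t) (hnodup : (content t).Nodup)
    (hx : ∀ b ∈ content t, b < x) : Increasing (slide x t) := by
  induction t using minimalChain_induction with
  | nil => exact ht
  | leaf a => simp [slide_leaf, Increasing]
  | left a b l r hl hr ih =>
    obtain ⟨-, -, hnodup_l, -, -⟩ := nodup_content_node.1 hnodup
    simp only [mem_content_node] at hx
    have hbx : b < x := hx b (.inr (.inl (mem_content_of_rootLabel? hl)))
    rw [slide_node_left hl hr]
    exact ⟨ht.2.2.1.lt_rootLabel?_slide hl hbx, hr,
      ih ht.2.2.1 hnodup_l fun d hd => hx d (.inr (.inl hd)), ht.2.2.2⟩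
  | right a c l r hl hr ih =>
    obtain ⟨-, -, -, hnodup_r, hdisj⟩ := nodup_content_node.1 hnodup
    simp only [mem_content_node] at hx
    have hc := mem_content_of_rootLabel? hr
    have hlt : ∀ b ∈ rootLabel? l, c < b := fun b hb => (hl b hb).lt_of_ne <| by
      rintro rfl
      exact Multiset.disjoint_left.1 hdisj (mem_content_of_rootLabel? hb) hc
    rw [slide_node_right hl hr]
    exact ⟨hlt, ht.2.2.2.lt_rootLabel?_slide hr (hx c (.inr (.inr hc))), ht.2.2.1,
      ih ht.2.2.2 hnodup_r fun d hd => hx d (.inr (.inr hd))⟩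

theorem unslide_slide (ha : rootLabel? t = some a) (hx : x ∉ content t) :
    unslide x a (slide x t) = t := by
  induction t using minimalChain_induction generalizing a with
  | nil => rfl
  | leaf a' => simp_all [slide_leaf, unslide]
  | left a' b l r hl hr ih =>
    obtain rfl : a' = a := by simpa using ha
    simp only [mem_content_node, not_or] at hx
    rw [slide_node_left hl hr, unslide,
      if_pos (mem_content_slide (ne_nil_of_rootLabel? hl) hx.2.1), ih hl hx.2.1]
  | right a' c l r hl hr ih =>
    obtain rfl : a' = a := by simpa using ha
    simp only [mem_content_node, not_or] at hx
    rw [slide_node_right hl hr, unslide, if_neg hx.2.1,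
      if_pos (mem_content_slide (ne_nil_of_rootLabel? hr) hx.2.2), ih hr hx.2.2]

theorem rootLabel?_unslide (ht : t ≠ .nil) : rootLabel? (unslide x y t) = some y := by
  cases t with
  | nil => exact absurd rfl ht
  | node a l r =>
    rw [unslide]
    split_ifs <;> rfl

theorem ne_nil_of_mem_content (h : x ∈ content t) : t ≠ .nil := by
  rintro rfl
  simp at h

theorem eq_nil_of_forall_notMem_content (h : ∀ x, x ∉ content t) : t = .nil := by
  cases t with
  | nil => rfl
  | node a l r => exact absurd (by simp) (h a)

theorem slide_unslide (ht : Increasing t) (hx : x ∈ content t) (hmax : ∀ b ∈ content t, b ≤ x) :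
    slide x (unslide x y t) = t := by
  induction t generalizing y with
  | nil => rfl
  | node a l r ihl ihr =>
    obtain ⟨hal, har, hl, hr⟩ := increasing_node.1 ht
    simp only [mem_content_node] at hmax hx
    rw [unslide]
    split_ifs with hxl hxr
    · rw [slide_node_left (rootLabel?_unslide (ne_nil_of_mem_content hxl)) ht.2.1,
        ihl hl hxl fun b hb => hmax b (.inr (.inl hb))]
    · rw [slide_node_right (fun b hb => (ht.1 b hb).le)
        (rootLabel?_unslide (ne_nil_of_mem_content hxr)),
        ihr hr hxr fun b hb => hmax b (.inr (.inr hb))]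
    · obtain rfl : x = a := hx.resolve_right (not_or.2 ⟨hxl, hxr⟩)
      have hl_nil : l = .nil := eq_nil_of_forall_notMem_content fun b hb =>
        (hal b hb).not_ge (hmax b (.inr (.inl hb)))
      have hr_nil : r = .nil := eq_nil_of_forall_notMem_content fun b hb =>
        (har b hb).not_ge (hmax b (.inr (.inr hb)))
      rw [hl_nil, hr_nil, slide_leaf]

theorem Increasing.unslide (ht : Increasing t) (hy : ∀ b ∈ rootLabel? t, y < b) :
    Increasing (unslide x y t) := by
  induction t generalizing y with
  | nil => trivial
  | node a l r ihl ihr =>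
    obtain ⟨hal, har, hl, hr⟩ := ht
    have hya : y < a := hy a rfl
    rw [SecantTree.unslide]
    split_ifs with hxl hxr
    · refine ⟨?_, fun c hc => hya.trans (har c hc), ihl hl hal, hr⟩
      simpa [rootLabel?_unslide (ne_nil_of_mem_content hxl)] using hya
    · refine ⟨fun b hb => hya.trans (hal b hb), ?_, hl, ihr hr har⟩
      simpa [rootLabel?_unslide (ne_nil_of_mem_content hxr)] using hya
    · exact ⟨fun b hb => hya.trans (hal b hb), fun c hc => hya.trans (har c hc), hl, hr⟩

theorem rootLabel?_slide_ne (hx : x ∉ content t) (hleaf : ∀ a, t ≠ leaf a) :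
    rootLabel? (slide x t) ≠ some x := by
  induction t using minimalChain_induction with
  | nil => simp [SecantTree.slide]
  | leaf a => exact absurd rfl (hleaf a)
  | left a b l r hl hr _ =>
    simp only [mem_content_node, not_or] at hx
    rw [slide_node_left hl hr, rootLabel?_node, ← hl]
    exact rootLabel?_ne_some hx.2.1
  | right a c l r hl hr _ =>
    simp only [mem_content_node, not_or] at hx
    rw [slide_node_right hl hr, rootLabel?_node, ← hr]
    exact rootLabel?_ne_some hx.2.2

theorem parent?_slide (ht : t ≠ .nil) (hx : x ∉ content t) (hleaf : ∀ a, t ≠ leaf a) :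
    parent? x (slide x t) = some (eoc t) := by
  induction t using minimalChain_induction with
  | nil => exact absurd rfl ht
  | leaf a => exact absurd rfl (hleaf a)
  | left a b l r hl hr ih =>
    simp only [mem_content_node, not_or] at hx
    rw [slide_node_left hl hr, eoc_node_left hl hr]
    by_cases hl_leaf : l = leaf b
    · simp [hl_leaf, slide_leaf, parent?]
    · have hl_leaf' : ∀ a, l ≠ leaf a := by rintro a rfl; simp_all
      rw [parent?_node_of_notMem_right (rootLabel?_slide_ne hx.2.1 hl_leaf') hx.2.2,
        ih (ne_nil_of_rootLabel? hl) hx.2.1 hl_leaf']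
  | right a c l r hl hr ih =>
    simp only [mem_content_node, not_or] at hx
    rw [slide_node_right hl hr, eoc_node_right hl hr]
    by_cases hr_leaf : r = leaf c
    · simp [hr_leaf, slide_leaf, parent?]
    · have hr_leaf' : ∀ a, r ≠ leaf a := by rintro a rfl; simp_all
      rw [parent?_node_of_notMem_left hx.2.1 (rootLabel?_slide_ne hx.2.2 hr_leaf'),
        ih (ne_nil_of_rootLabel? hr) hx.2.2 hr_leaf']

end MinimalChain

/-! ### Secant trees on a set of labels -/

/-- The complete increasing trees of even size whose set of labels is `S`: the shape required by
`FullExceptRightmost` has an even number of nodes, and comparing multisets makes the labels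
distinct. -/
def secantTrees (S : Finset ℕ) : Set (BinaryTree ℕ) :=
  {t | content t = S.val ∧ Increasing t ∧ FullExceptRightmost t}

section SecantTrees

variable {a b k m x N : ℕ} {S : Finset ℕ} {l r t : BinaryTree ℕ}

theorem mem_content_iff (ht : t ∈ secantTrees S) : x ∈ content t ↔ x ∈ S := by
  rw [ht.1, Finset.mem_val]

theorem nodup_content (ht : t ∈ secantTrees S) : (content t).Nodup :=
  ht.1 ▸ S.nodup

theorem ne_leaf_of_mem_secantTrees (ht : t ∈ secantTrees S) : t ≠ leaf a := by
  rintro rfl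
  exact ht.2.2.1 rfl

theorem Increasing.rootLabel?_eq_of_forall_le (ht : Increasing t) (ha : a ∈ content t)
    (hle : ∀ b ∈ content t, a ≤ b) : rootLabel? t = some a := by
  obtain ⟨d, hd⟩ := exists_rootLabel?_eq_some (ne_nil_of_mem_content ha)
  rw [hd, (ht.le_of_mem hd ha).antisymm (hle d (mem_content_of_rootLabel? hd))]

theorem rootLabel?_of_mem_secantTrees_insert (ht : t ∈ secantTrees (insert a S))
    (ha : ∀ b ∈ S, a < b) : rootLabel? t = some a := by
  refine ht.2.1.rootLabel?_eq_of_forall_le ((mem_content_iff ht).2 (S.mem_insert_self a))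
    fun b hb => ?_
  rcases Finset.mem_insert.1 ((mem_content_iff ht).1 hb) with rfl | hb
  · rfl
  · exact (ha b hb).le

theorem Increasing.eq_leaf_of_rootLabel?_eq_eoc (ht : Increasing t)
    (h : rootLabel? t = some (eoc t)) : t = leaf (eoc t) := by
  have absurd_of_lt {a b : ℕ} {l r s : BinaryTree ℕ} (hs : rootLabel? s = some b)
      (has : ∀ c ∈ content s, a < c) (h : rootLabel? (.node a l r) = some (eoc s)) : False :=
    (has _ (eoc_mem (ne_nil_of_rootLabel? hs))).ne (by simpa using h)
  induction t using minimalChain_induction with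
  | nil => simp at h
  | leaf a => rfl
  | left a b l r hl hr _ =>
    exact (absurd_of_lt hl (increasing_node.1 ht).1 (eoc_node_left hl hr ▸ h)).elim
  | right a c l r hl hr _ =>
    exact (absurd_of_lt hr (increasing_node.1 ht).2.1 (eoc_node_right hl hr ▸ h)).elim

theorem content_eq_Icc_val :
    content t = (Finset.Icc 1 N).val ↔ (labels t).Perm (List.range' 1 N) := by
  rw [Nat.Icc_eq_range', Nat.add_sub_cancel]
  exact Multiset.coe_eq_coe

theorem one_le_of_mem_secantTrees (ht : t ∈ secantTrees (.Icc 1 N)) : 1 ≤ N := by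
  have hmem := (mem_content_iff ht).1 (eoc_mem ht.2.2.ne_nil)
  exact (Finset.mem_Icc.1 hmem).1.trans (Finset.mem_Icc.1 hmem).2

theorem rootLabel?_of_mem_secantTrees (ht : t ∈ secantTrees (.Icc 1 N)) :
    rootLabel? t = some 1 := by
  rw [← Finset.insert_Icc_add_one_left_eq_Icc (one_le_of_mem_secantTrees ht)] at ht
  exact rootLabel?_of_mem_secantTrees_insert ht fun b hb => (Finset.mem_Icc.1 hb).1

theorem isCompleteIncreasing_iff (hN : Even N) :
    IsCompleteIncreasing N t ↔ t ∈ secantTrees (.Icc 1 N) := by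
  have hroot : t ∈ secantTrees (.Icc 1 N) → rootLabel? t = some 1 := rootLabel?_of_mem_secantTrees
  simp only [IsCompleteIncreasing, IsIncreasingTree, hN, if_true, secantTrees, Set.mem_ofPred_eq,
    content_eq_Icc_val] at hroot ⊢
  tauto

theorem finite_secantTrees (hN : Even N) : (secantTrees (.Icc 1 N)).Finite :=
  (finite_completeIncreasing N).subset fun _ ht => (isCompleteIncreasing_iff hN).2 ht

theorem eoc_mem_Icc (ht : t ∈ secantTrees (.Icc 1 N)) : eoc t ∈ Finset.Icc 2 N := by
  have hmem := Finset.mem_Icc.1 ((mem_content_iff ht).1 (eoc_mem ht.2.2.ne_nil))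
  have hne : eoc t ≠ 1 := fun h => ne_leaf_of_mem_secantTrees ht <|
    ht.2.1.eq_leaf_of_rootLabel?_eq_eoc (h ▸ rootLabel?_of_mem_secantTrees ht)
  exact Finset.mem_Icc.2 ⟨by omega, hmem.2⟩

theorem Increasing.parent?_lt (ht : Increasing t) (h : parent? x t = some k) : k < x := by
  obtain ⟨C, l, r, rfl, hx⟩ := TreeContext.exists_fill_of_parent? h
  have hkids := TreeContext.increasing_of_fill ht
  exact hx.elim (hkids.1 x) (hkids.2.1 x)

theorem mem_content_of_parent? (h : parent? x t = some k) : k ∈ content t := by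
  obtain ⟨C, l, r, rfl, -⟩ := TreeContext.exists_fill_of_parent? h
  exact TreeContext.mem_content_fill_of_rootLabel? rfl

theorem ncard_eq_sum_ncard_fiberwise {α β : Type*} {s : Set α} (hs : s.Finite) {I : Finset β}
    {g : α → β} (hg : Set.MapsTo g s I) :
    s.ncard = ∑ i ∈ I, {a ∈ s | g a = i}.ncard := by
  classical
  lift s to Finset α using hs
  simp_rw [Finset.mem_coe, ← Finset.coe_filter, Set.ncard_coe_finset]
  exact Finset.card_eq_sum_card_fiberwise hg

theorem f_eq_ncard (hN : Even N) :
    f N m k = {t ∈ secantTrees (.Icc 1 N) | eoc t = m ∧ parent? N t = some k}.ncard := by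
  simp only [f, isCompleteIncreasing_iff hN, pom?]

theorem exists_parent?_mem_Icc (ht : t ∈ secantTrees (.Icc 1 N)) :
    ∃ k ∈ Finset.Icc 1 (N - 1), parent? N t = some k := by
  have heoc := Finset.mem_Icc.1 (eoc_mem_Icc ht)
  have hmem : N ∈ content t := (mem_content_iff ht).2 (Finset.mem_Icc.2 ⟨by omega, le_rfl⟩)
  have hroot : rootLabel? t ≠ some N := by
    rw [rootLabel?_of_mem_secantTrees ht, ne_eq, Option.some_inj]
    omega
  obtain ⟨k, hk⟩ := Option.isSome_iff_exists.1 (isSome_parent? hmem hroot)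
  have hkN := ht.2.1.parent?_lt hk
  have hk1 := Finset.mem_Icc.1 ((mem_content_iff ht).1 (mem_content_of_parent? hk))
  exact ⟨k, Finset.mem_Icc.2 ⟨hk1.1, by omega⟩, hk⟩

theorem rowSum_eq_ncard (hN : Even N) :
    rowSum N m = {t ∈ secantTrees (.Icc 1 N) | eoc t = m}.ncard := by
  rw [ncard_eq_sum_ncard_fiberwise ((finite_secantTrees hN).subset (Set.sep_subset _ _))
    (I := (Finset.Icc 1 (N - 1)).map .some) (g := parent? N), Finset.sum_map]
  · simp only [rowSum, f_eq_ncard hN, Set.mem_ofPred_eq, and_assoc, Function.Embedding.some_apply]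
  · rintro t ⟨ht, -⟩
    simpa [eq_comm] using exists_parent?_mem_Icc ht

theorem colSum_eq_ncard (hN : Even N) :
    colSum N k = {t ∈ secantTrees (.Icc 1 N) | parent? N t = some k}.ncard := by
  rw [ncard_eq_sum_ncard_fiberwise ((finite_secantTrees hN).subset (Set.sep_subset _ _))
    (I := Finset.Icc 2 N) (g := eoc) fun t ht => eoc_mem_Icc ht.1]
  simp only [colSum, f_eq_ncard hN, Set.mem_ofPred_eq, and_assoc, and_comm (a := eoc _ = _)]

end SecantTrees

/-! ### Relabelling -/

section Relabel

variable {x M : ℕ} {g : ℕ → ℕ} {S : Finset ℕ} {t : BinaryTree ℕ}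

theorem content_map : content (t.map g) = (content t).map g := by
  induction t with
  | nil => rfl
  | node a l r ihl ihr => simp [BinaryTree.map, ihl, ihr]

theorem rootLabel?_map : rootLabel? (t.map g) = (rootLabel? t).map g := by
  cases t <;> rfl

theorem map_eq_nil : t.map g = .nil ↔ t = .nil := by
  cases t <;> simp [BinaryTree.map]

theorem everyNodeFull_map : EveryNodeFull (t.map g) ↔ EveryNodeFull t := by
  induction t with
  | nil => rfl
  | node a l r ihl ihr => simp [BinaryTree.map, EveryNodeFull, map_eq_nil, ihl, ihr]

theorem fullExceptRightmost_map : FullExceptRightmost (t.map g) ↔ FullExceptRightmost t := by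
  induction t with
  | nil => rfl
  | node a l r _ ihr =>
    simp [BinaryTree.map, FullExceptRightmost, map_eq_nil, everyNodeFull_map, ihr]

theorem increasing_map (hg : StrictMono g) : Increasing (t.map g) ↔ Increasing t := by
  induction t with
  | nil => rfl
  | node a l r ihl ihr =>
    simp [BinaryTree.map, Increasing, rootLabel?_map, ihl, ihr, hg.lt_iff_lt]

theorem parent?_map (hg : g.Injective) : parent? (g x) (t.map g) = (parent? x t).map g := by
  have rootLabel?_map_eq (s : BinaryTree ℕ) :
      rootLabel? (s.map g) = some (g x) ↔ rootLabel? s = some x := by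
    rw [rootLabel?_map, ← Option.map_some, (Option.map_injective hg).eq_iff]
  induction t with
  | nil => rfl
  | node a l r ihl ihr =>
    simp only [BinaryTree.map, parent?, rootLabel?_map_eq, ihl, ihr]
    split_ifs
    · rfl
    · cases parent? x l <;> rfl

theorem eoc_map (hg : StrictMono g) (ht : t ≠ .nil) : eoc (t.map g) = g (eoc t) := by
  induction t using minimalChain_induction with
  | nil => exact absurd rfl ht
  | leaf a => rfl
  | left a b l r hl hr ih =>
    rw [BinaryTree.map, eoc_node_left (b := g b) (by simp [rootLabel?_map, hl])
      (by simpa [rootLabel?_map, hg.lt_iff_lt] using hr), ih (ne_nil_of_rootLabel? hl),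
      eoc_node_left hl hr]
  | right a c l r hl hr ih =>
    rw [BinaryTree.map, eoc_node_right (c := g c)
      (by simpa [rootLabel?_map, hg.le_iff_le] using hl) (by simp [rootLabel?_map, hr]),
      ih (ne_nil_of_rootLabel? hr), eoc_node_right hl hr]

theorem map_injective (hg : g.Injective) : Function.Injective (BinaryTree.map g) :=
  Function.LeftInverse.injective (g := BinaryTree.map (Function.invFun g)) fun t => by
    rw [← BinaryTree.comp_map, Function.invFun_comp hg, BinaryTree.id_map]

theorem exists_map_eq (h : ∀ x ∈ content t, x ∈ Set.range g) : ∃ s, BinaryTree.map g s = t := by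
  induction t with
  | nil => exact ⟨.nil, rfl⟩
  | node a l r ihl ihr =>
    simp only [mem_content_node] at h
    obtain ⟨b, rfl⟩ := h a (.inl rfl)
    obtain ⟨l', rfl⟩ := ihl fun x hx => h x (.inr (.inl hx))
    obtain ⟨r', rfl⟩ := ihr fun x hx => h x (.inr (.inr hx))
    exact ⟨.node b l' r', rfl⟩

theorem map_mem_secantTrees_image (hg : StrictMono g) :
    t.map g ∈ secantTrees (S.image g) ↔ t ∈ secantTrees S := by
  simp only [secantTrees, Set.mem_ofPred_eq, content_map, increasing_map hg,
    fullExceptRightmost_map, Finset.image_val_of_injOn hg.injective.injOn,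
    (Multiset.map_injective hg.injective).eq_iff]

theorem map_bijOn (hg : StrictMono g) :
    Set.BijOn (BinaryTree.map g) (secantTrees S) (secantTrees (S.image g)) := by
  refine ⟨fun t ht => (map_mem_secantTrees_image hg).2 ht, (map_injective hg.injective).injOn,
    fun t ht => ?_⟩
  have hrange : ∀ x ∈ content t, x ∈ Set.range g := fun x hx => by
    obtain ⟨y, -, rfl⟩ := Finset.mem_image.1 ((mem_content_iff ht).1 hx)
    exact Set.mem_range_self y
  obtain ⟨s, rfl⟩ := exists_map_eq hrange
  exact ⟨s, (map_mem_secantTrees_image hg).1 ht, rfl⟩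

theorem ncard_sep_eq_of_bijOn {α β : Type*} {g : α → β} {s : Set α} {t : Set β}
    (h : Set.BijOn g s t) {p : α → Prop} {q : β → Prop} (hpq : ∀ a ∈ s, (q (g a) ↔ p a)) :
    {b ∈ t | q b}.ncard = {a ∈ s | p a}.ncard := by
  have hbij : Set.BijOn g {a ∈ s | p a} {b ∈ t | q b} := by
    refine ⟨fun a ha => ⟨h.mapsTo ha.1, (hpq a ha.1).2 ha.2⟩, h.injOn.mono fun _ ha => ha.1, ?_⟩
    rintro b ⟨hb, hqb⟩
    obtain ⟨a, ha, rfl⟩ := h.surjOn hb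
    exact ⟨a, ⟨ha, (hpq a ha).1 hqb⟩, rfl⟩
  exact hbij.ncard_eq.symm

theorem ncard_parent?_map_add (d k : ℕ) :
    {t ∈ secantTrees (.Icc (1 + d) (M + d)) | parent? (M + d) t = some (k + d)}.ncard =
      {t ∈ secantTrees (.Icc 1 M) | parent? M t = some k}.ncard := by
  rw [← Finset.image_add_right_Icc]
  refine ncard_sep_eq_of_bijOn (map_bijOn (add_left_strictMono (a := d))) fun t _ => ?_
  rw [parent?_map (add_left_injective d) (x := M)]
  simp

end Relabel

/-! ### Equidistribution of `eoc` and `pom + 1` -/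

section Equidistribution

variable {a k x M : ℕ} {S : Finset ℕ} {t : BinaryTree ℕ}

theorem content_slide_eq_iff (ha : a ∉ S) (hx : x ∉ S) (hroot : rootLabel? t = some a) :
    content (slide x t) = (insert x S).val ↔ content t = (insert a S).val := by
  rw [Finset.insert_val_of_notMem ha, Finset.insert_val_of_notMem hx,
    ← Multiset.cons_inj_right a, cons_content_slide hroot, Multiset.cons_swap a x,
    Multiset.cons_inj_right]

theorem slide_bijOn (ha : ∀ b ∈ S, a < b) (hx : ∀ b ∈ S, b < x) (hax : a < x) :
    Set.BijOn (slide x) (secantTrees (insert a S)) (secantTrees (insert x S)) := by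
  have haS : a ∉ S := fun h => (ha a h).false
  have hxS : x ∉ S := fun h => (hx x h).false
  have hlt : ∀ b ∈ insert a S, b < x := by simpa [hax] using hx
  have hle : ∀ b ∈ insert x S, b ≤ x := by simpa using fun b hb => (hx b hb).le
  have halt : ∀ b ∈ insert x S, a < b := by simpa [hax] using ha
  have hroot : ∀ t ∈ secantTrees (insert a S), rootLabel? t = some a :=
    fun t ht => rootLabel?_of_mem_secantTrees_insert ht ha
  have hslide : ∀ t ∈ secantTrees (insert x S), slide x (unslide x a t) = t := fun t ht =>
    slide_unslide ht.2.1 ((mem_content_iff ht).2 (S.mem_insert_self x))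
      fun b hb => hle b ((mem_content_iff ht).1 hb)
  refine Set.InvOn.bijOn (f' := unslide x a) ⟨fun t ht => ?_, hslide⟩ (fun t ht => ?_)
    fun t ht => ?_
  · exact unslide_slide (hroot t ht) fun h => (hlt x ((mem_content_iff ht).1 h)).false
  · exact ⟨(content_slide_eq_iff haS hxS (hroot t ht)).2 ht.1,
      ht.2.1.slide (nodup_content ht) fun b hb => hlt b ((mem_content_iff ht).1 hb),
      fullExceptRightmost_slide.2 ht.2.2⟩
  · refine ⟨(content_slide_eq_iff (x := x) haS hxS (rootLabel?_unslide ht.2.2.ne_nil)).1 ?_,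
      ht.2.1.unslide fun b hb => ?_, (fullExceptRightmost_slide (x := x)).1 ?_⟩
    · rw [hslide t ht, ht.1]
    · exact halt b ((mem_content_iff ht).1 (mem_content_of_rootLabel? hb))
    · exact (hslide t ht).symm ▸ ht.2.2

theorem ncard_parent?_eq_ncard_eoc (hM : 1 ≤ M) :
    {t ∈ secantTrees (.Icc 2 (M + 1)) | parent? (M + 1) t = some k}.ncard =
      {t ∈ secantTrees (.Icc 1 M) | eoc t = k}.ncard := by
  have hbij : Set.BijOn (slide (M + 1)) (secantTrees (.Icc 1 M))
      (secantTrees (.Icc 2 (M + 1))) := by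
    rw [← Finset.insert_Icc_add_one_left_eq_Icc hM,
      ← Finset.insert_Icc_right_eq_Icc_add_one (by omega)]
    exact slide_bijOn (by simp; omega) (by simp) (by omega)
  refine ncard_sep_eq_of_bijOn hbij fun t ht => ?_
  have hx : M + 1 ∉ content t := by
    rw [mem_content_iff ht, Finset.mem_Icc]
    omega
  rw [parent?_slide ht.2.2.ne_nil hx fun a => ne_leaf_of_mem_secantTrees ht, Option.some_inj]

theorem rowSum_succ_eq_colSum (hM : Even M) (hM1 : 1 ≤ M) : rowSum M (k + 1) = colSum M k := by
  rw [rowSum_eq_ncard hM, colSum_eq_ncard hM, ← ncard_parent?_eq_ncard_eoc hM1]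
  exact ncard_parent?_map_add 1 k

end Equidistribution

/-! ### The first two rows -/

section TopRows

variable {a b c k x M : ℕ} {S : Finset ℕ} {l r s t : BinaryTree ℕ}

theorem Increasing.eq_leaf_of_eoc_le (ht : Increasing t) (hne : t ≠ .nil)
    (h : ∀ x ∈ content t, eoc t ≤ x) : t = leaf (eoc t) :=
  ht.eq_leaf_of_rootLabel?_eq_eoc (ht.rootLabel?_eq_of_forall_le (eoc_mem hne) h)

theorem Increasing.exists_eq_node_leaf (ht : Increasing t) (hroot : rootLabel? t = some a)
    (heoc : eoc t = b) (hab : a ≠ b) (hmin : ∀ x ∈ content t, x = a ∨ b ≤ x) :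
    ∃ s, t = .node a (leaf b) s ∨ t = .node a s (leaf b) := by
  obtain ⟨l, r, rfl⟩ := rootLabel?_eq_some.1 hroot
  obtain ⟨hal, har, hl, hr⟩ := increasing_node.1 ht
  rcases minimalChain_cases l r with ⟨rfl, rfl⟩ | ⟨c, hlc, hrc⟩ | ⟨c, hlc, hrc⟩
  · exact absurd heoc hab
  · rw [eoc_node_left hlc hrc] at heoc
    subst heoc
    have hl_leaf := hl.eq_leaf_of_eoc_le (ne_nil_of_rootLabel? hlc) fun x hx =>
      (hmin x (by simp [hx])).resolve_left (hal x hx).ne'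
    exact ⟨r, .inl (by rw [← hl_leaf])⟩
  · rw [eoc_node_right hlc hrc] at heoc
    subst heoc
    have hr_leaf := hr.eq_leaf_of_eoc_le (ne_nil_of_rootLabel? hrc) fun x hx =>
      (hmin x (by simp [hx])).resolve_left (har x hx).ne'
    exact ⟨l, .inr (by rw [← hr_leaf])⟩

theorem FullExceptRightmost.right_ne_leaf (ht : FullExceptRightmost (.node a l r)) :
    r ≠ leaf b := by
  rintro rfl
  simp [FullExceptRightmost] at ht

theorem leaf_bijOn (hab : a < b) (hb : ∀ c ∈ S, b < c) (hS : S.Nonempty) :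
    Set.BijOn (.node a (leaf b)) (secantTrees S)
      {t ∈ secantTrees (insert a (insert b S)) | eoc t = b} := by
  have haS : a ∉ insert b S := by
    simpa [hab.ne] using fun h => (hb a h).asymm hab
  have hbS : b ∉ S := fun h => (hb b h).false
  have hcontent (r : BinaryTree ℕ) : content (.node a (leaf b) r) = (insert a (insert b S)).val ↔
      content r = S.val := by
    simp [Finset.insert_val_of_notMem haS, Finset.insert_val_of_notMem hbS]
  refine ⟨fun r hr => ?_, fun r _ r' _ h => (BinaryTree.node.inj h).2.2, ?_⟩
  · have hlt : ∀ c ∈ content r, b < c := fun c hc => hb c ((mem_content_iff hr).1 hc)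
    refine ⟨⟨(hcontent r).2 hr.1, increasing_node.2 ⟨by simpa using hab,
      fun c hc => hab.trans (hlt c hc), by simp [Increasing], hr.2.1⟩,
      ⟨by simp, by simp [EveryNodeFull], .inr hr.2.2⟩⟩, ?_⟩
    exact eoc_node_left rfl fun c hc => hlt c (mem_content_of_rootLabel? hc)
  · rintro t ⟨ht, heoc⟩
    have hroot : rootLabel? t = some a := rootLabel?_of_mem_secantTrees_insert ht
      (by simpa [hab] using fun c hc => hab.trans (hb c hc))
    have hmin : ∀ x ∈ content t, x = a ∨ b ≤ x := fun x hx => by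
      have hxS := (mem_content_iff ht).1 hx
      simp only [Finset.mem_insert] at hxS
      exact hxS.imp_right fun h => h.elim (·.ge) fun h => (hb x h).le
    obtain ⟨r, rfl | rfl⟩ := ht.2.1.exists_eq_node_leaf hroot heoc hab.ne hmin
    swap; · exact absurd rfl ht.2.2.right_ne_leaf
    have hrS := (hcontent r).1 ht.1
    refine ⟨r, ⟨hrS, ht.2.1.2.2.2, ht.2.2.2.2.resolve_left ?_⟩, rfl⟩
    rintro rfl
    exact hS.ne_empty (Finset.val_eq_zero.1 hrS.symm)

theorem f_two_eq_ncard (hM : Even M) (hM2 : 2 ≤ M) :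
    f (M + 2) 2 k = {t ∈ secantTrees (.Icc 3 (M + 2)) | parent? (M + 2) t = some k}.ncard := by
  have hIcc : insert 1 (insert 2 (Finset.Icc 3 (M + 2))) = .Icc 1 (M + 2) := by
    ext
    simp only [Finset.mem_insert, Finset.mem_Icc]
    omega
  have hbij := leaf_bijOn (S := .Icc 3 (M + 2)) one_lt_two (by simp; omega)
    (Finset.nonempty_Icc.2 (by omega))
  rw [hIcc] at hbij
  simp only [f_eq_ncard (hM.add even_two), ← and_assoc]
  refine ncard_sep_eq_of_bijOn hbij fun t ht => ?_
  rw [← Finset.insert_Icc_add_one_left_eq_Icc (by omega)] at ht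
  have hroot : rootLabel? t = some 3 :=
    rootLabel?_of_mem_secantTrees_insert ht fun b hb => (Finset.mem_Icc.1 hb).1
  rw [parent?_node_of_notMem_left (by simp; omega) (by simp [hroot]; omega)]

theorem f_two_eq_colSum (hM : Even M) (hM2 : 2 ≤ M) : f (M + 2) 2 (k + 2) = colSum M k := by
  rw [f_two_eq_ncard hM hM2, colSum_eq_ncard hM]
  exact ncard_parent?_map_add 2 k

end TopRows

section Graft

variable {a b c k x M : ℕ} {i : Fin 3} {S : Finset ℕ} {l r s t : BinaryTree ℕ}

/-- The three trees with root `a` and minimal chain `a, b, c` obtained from a tree with root `c`: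
the leaf `c` is placed on the left or on the right below `b`, and `b` on the left or on the right
below `a`; the fourth combination would make `c` the rightmost node. -/
def graft (a b : ℕ) : Fin 3 → BinaryTree ℕ → BinaryTree ℕ
  | _, .nil => .nil
  | 0, .node c l r => .node a (.node b (leaf c) l) r
  | 1, .node c l r => .node a (.node b l (leaf c)) r
  | 2, .node c l r => .node a l (.node b (leaf c) r)

theorem content_graft :
    content (graft a b i (.node c l r)) = a ::ₘ b ::ₘ content (.node c l r) := by
  fin_cases i <;> simp only [graft, content_node, content_nil, ← Multiset.singleton_add] <;> abel

theorem fullExceptRightmost_graft :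
    FullExceptRightmost (graft a b i (.node c l r)) ↔ FullExceptRightmost (.node c l r) := by
  fin_cases i <;> simp [graft, FullExceptRightmost, EveryNodeFull, eq_comm, and_assoc]

theorem increasing_graft (hab : a < b) (hbc : b < c) (hl : ∀ x ∈ content l, c < x)
    (hr : ∀ x ∈ content r, c < x) :
    Increasing (graft a b i (.node c l r)) ↔ Increasing (.node c l r) := by
  have hac := hab.trans hbc
  have hnil : Increasing .nil := trivial
  fin_cases i <;>
    simp +contextual [graft, increasing_node, hnil, hab, hbc, hac, hl, hr, hac.trans, hbc.trans,
      or_imp]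

theorem graft_mem_secantTrees_iff (hab : a < b) (hbc : b < c) (hc : ∀ x ∈ S, c < x) :
    graft a b i (.node c l r) ∈ secantTrees (insert a (insert b (insert c S))) ↔
      .node c l r ∈ secantTrees (insert c S) := by
  have hcS : c ∉ S := fun h => (hc c h).false
  have hbS : b ∉ insert c S := by simpa [hbc.ne] using fun h => (hc b h).asymm hbc
  have haS : a ∉ insert b (insert c S) := by
    simpa [hab.ne, (hab.trans hbc).ne] using fun h => (hc a h).asymm (hab.trans hbc)
  simp only [secantTrees, Set.mem_ofPred_eq, content_graft, Finset.insert_val_of_notMem haS,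
    Finset.insert_val_of_notMem hbS, Multiset.cons_inj_right, fullExceptRightmost_graft]
  refine and_congr_right fun h => and_congr_left' (increasing_graft hab hbc ?_ ?_)
  all_goals
    rw [content_node, Finset.insert_val_of_notMem hcS, Multiset.cons_inj_right] at h
    exact fun x hx => hc x (by simp [← Finset.mem_val, ← h, hx])

theorem eoc_graft (hbc : b < c) (hl : ∀ x ∈ content l, c < x) (hr : ∀ x ∈ content r, c < x) :
    eoc (graft a b i (.node c l r)) = c := by
  have hl' : ∀ x ∈ rootLabel? l, c < x := fun x hx => hl x (mem_content_of_rootLabel? hx)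
  have hr' : ∀ x ∈ rootLabel? r, c < x := fun x hx => hr x (mem_content_of_rootLabel? hx)
  fin_cases i
  · exact (eoc_node_left rfl fun x hx => hbc.trans (hr' x hx)).trans (eoc_node_left rfl hl')
  · exact (eoc_node_left rfl fun x hx => hbc.trans (hr' x hx)).trans
      (eoc_node_right (fun x hx => (hl' x hx).le) rfl)
  · exact (eoc_node_right (fun x hx => (hbc.trans (hl' x hx)).le) rfl).trans
      (eoc_node_left rfl hr')

theorem parent?_graft (hbx : b ≠ x) (hcx : c ≠ x) (hak : a ≠ k) (hbk : b ≠ k) (hck : c ≠ k)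
    (hdisj : Disjoint (content l) (content r)) :
    parent? x (graft a b i (.node c l r)) = some k ↔ parent? x (.node c l r) = some k := by
  have hl : rootLabel? r = some x → parent? x l = none := fun h =>
    parent?_eq_none (Multiset.disjoint_right.1 hdisj (mem_content_of_rootLabel? h))
  by_cases hxl : rootLabel? l = some x <;> by_cases hxr : rootLabel? r = some x <;> fin_cases i <;>
    simp_all [graft, parent?]

theorem exists_graft_eq (hab : a < b) (hbc : b < c) (hc : ∀ x ∈ S, c < x)
    (ht : t ∈ secantTrees (insert a (insert b (insert c S)))) (heoc : eoc t = c) :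
    ∃ i l r, graft a b i (.node c l r) = t := by
  have hlt : ∀ x ∈ insert b (insert c S), a < x := by
    simpa [hab, hab.trans hbc] using fun x hx => (hab.trans hbc).trans (hc x hx)
  obtain ⟨l, r, rfl⟩ := rootLabel?_eq_some.1 (rootLabel?_of_mem_secantTrees_insert ht hlt)
  obtain ⟨hal, har, hl, hr⟩ := increasing_node.1 ht.2.1
  have hmin : ∀ x ∈ content (.node a l r), a < x → x = b ∨ c ≤ x := fun x hx hax => by
    have := (mem_content_iff ht).1 hx
    simp only [Finset.mem_insert, hax.ne', false_or] at this
    exact this.imp_right fun h => h.elim (·.ge) fun h => (hc x h).le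
  have hmin_l : ∀ x ∈ content l, x = b ∨ c ≤ x := fun x hx => hmin x (by simp [hx]) (hal x hx)
  have hmin_r : ∀ x ∈ content r, x = b ∨ c ≤ x := fun x hx => hmin x (by simp [hx]) (har x hx)
  have hb : b ∈ content (.node a l r) := (mem_content_iff ht).2 (by simp)
  rcases (mem_content_node.1 hb).resolve_left hab.ne' with hbl | hbr
  · have hroot : rootLabel? l = some b := hl.rootLabel?_eq_of_forall_le hbl fun x hx =>
      (hmin_l x hx).elim (·.ge) hbc.le.trans
    have hbr : ∀ x ∈ rootLabel? r, b < x := fun x hx => by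
      have hxr := mem_content_of_rootLabel? hx
      refine hbc.trans_le ((hmin_r x hxr).resolve_left ?_)
      rintro rfl
      exact Multiset.disjoint_left.1 (nodup_content_node.1 (nodup_content ht)).2.2.2.2 hbl hxr
    rw [eoc_node_left hroot hbr] at heoc
    obtain ⟨s, rfl | rfl⟩ := hl.exists_eq_node_leaf hroot heoc hbc.ne hmin_l
    · exact ⟨0, s, r, rfl⟩
    · exact ⟨1, s, r, rfl⟩
  · have hroot : rootLabel? r = some b := hr.rootLabel?_eq_of_forall_le hbr fun x hx =>
      (hmin_r x hx).elim (·.ge) hbc.le.trans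
    have hbl : ∀ x ∈ rootLabel? l, b ≤ x := fun x hx =>
      (hmin_l x (mem_content_of_rootLabel? hx)).elim (·.ge) hbc.le.trans
    rw [eoc_node_right hbl hroot] at heoc
    obtain ⟨s, rfl | rfl⟩ := hr.exists_eq_node_leaf hroot heoc hbc.ne hmin_r
    · exact ⟨2, l, s, rfl⟩
    · exact absurd rfl (ht.2.2.2.2.resolve_left (by simp)).right_ne_leaf

theorem graft_inj {i' : Fin 3} {l' r' : BinaryTree ℕ} (hl : c ∉ content l) (hr : c ∉ content r)
    (h : graft a b i (.node c l r) = graft a b i' (.node c l' r')) :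
    i = i' ∧ l = l' ∧ r = r' := by
  have hcl {s : BinaryTree ℕ} (h : leaf c = s) : l ≠ s := by
    rintro rfl
    simp [← h] at hl
  fin_cases i <;> fin_cases i' <;> simp_all [graft]

theorem graft_bijOn (hab : a < b) (hbc : b < c) (hc : ∀ x ∈ S, c < x) :
    Set.BijOn (fun p : Fin 3 × BinaryTree ℕ => graft a b p.1 p.2)
      (Set.univ ×ˢ secantTrees (insert c S))
      {t ∈ secantTrees (insert a (insert b (insert c S))) | eoc t = c} := by
  have exists_node {s : BinaryTree ℕ} (hs : s ∈ secantTrees (insert c S)) :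
      ∃ l r, s = .node c l r ∧ (∀ x ∈ content l, c < x) ∧ ∀ x ∈ content r, c < x := by
    obtain ⟨l, r, rfl⟩ := rootLabel?_eq_some.1 (rootLabel?_of_mem_secantTrees_insert hs hc)
    obtain ⟨hl, hr, -, -⟩ := increasing_node.1 hs.2.1
    exact ⟨l, r, rfl, hl, hr⟩
  refine ⟨?_, ?_, fun t ht => ?_⟩
  · rintro ⟨i, s⟩ ⟨-, hs⟩
    obtain ⟨l, r, rfl, hl, hr⟩ := exists_node hs
    exact ⟨(graft_mem_secantTrees_iff hab hbc hc).2 hs, eoc_graft hbc hl hr⟩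
  · rintro ⟨i, s⟩ ⟨-, hs⟩ ⟨i', s'⟩ ⟨-, hs'⟩ h
    obtain ⟨l, r, rfl, hl, hr⟩ := exists_node hs
    obtain ⟨l', r', rfl, -⟩ := exists_node hs'
    obtain ⟨rfl, rfl, rfl⟩ :=
      graft_inj (fun hcl => (hl c hcl).false) (fun hcr => (hr c hcr).false) h
    rfl
  · obtain ⟨i, l, r, rfl⟩ := exists_graft_eq hab hbc hc ht.1 ht.2
    exact ⟨(i, .node c l r), ⟨trivial, (graft_mem_secantTrees_iff hab hbc hc).1 ht.1⟩, rfl⟩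

theorem f_three_eq (hM : Even M) (hM2 : 2 ≤ M) (hk : 4 ≤ k) :
    f (M + 2) 3 k = 3 * f (M + 2) 2 k := by
  have hIcc3 : insert 3 (Finset.Icc 4 (M + 2)) = .Icc 3 (M + 2) :=
    Finset.insert_Icc_add_one_left_eq_Icc (by omega)
  have hIcc1 : insert 1 (insert 2 (Finset.Icc 3 (M + 2))) = .Icc 1 (M + 2) := by
    ext
    simp only [Finset.mem_insert, Finset.mem_Icc]
    omega
  have hbij := graft_bijOn (S := .Icc 4 (M + 2)) (show 1 < 2 by omega) (show 2 < 3 by omega)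
    (by simp; omega)
  rw [hIcc3, hIcc1] at hbij
  have hparent : ∀ p ∈ Set.univ ×ˢ secantTrees (.Icc 3 (M + 2)),
      (parent? (M + 2) (graft 1 2 p.1 p.2) = some k ↔ parent? (M + 2) p.2 = some k) := by
    rintro ⟨i, s⟩ ⟨-, hs⟩
    obtain ⟨l, r, rfl⟩ := rootLabel?_eq_some.1 <|
      rootLabel?_of_mem_secantTrees_insert (hIcc3 ▸ hs) fun b hb => (Finset.mem_Icc.1 hb).1
    exact parent?_graft (by omega) (by omega) (by omega) (by omega) (by omega)
      (nodup_content_node.1 (nodup_content hs)).2.2.2.2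
  simp only [f_two_eq_ncard hM hM2, f_eq_ncard (hM.add even_two), ← and_assoc]
  refine (ncard_sep_eq_of_bijOn hbij hparent).trans ?_
  trans (Set.univ (α := Fin 3) ×ˢ {s ∈ secantTrees (.Icc 3 (M + 2)) |
    parent? (M + 2) s = some k}).ncard
  · congr 1
    ext
    simp
  · rw [Set.ncard_prod, Set.ncard_univ, Nat.card_fin]

end Graft

/-! ### The last two columns -/

section LastColumns

variable {a b c k m x y M : ℕ} {S S' : Finset ℕ} {C : TreeContext} {l r l' r' s s' t : BinaryTree ℕ}

theorem Increasing.le_eoc (ht : Increasing t) (ha : rootLabel? t = some a) : a ≤ eoc t :=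
  ht.le_of_mem ha (eoc_mem (ne_nil_of_rootLabel? ha))

theorem eoc_node_congr (hl : rootLabel? l = rootLabel? l') (hr : rootLabel? r = rootLabel? r')
    (hlm : eoc l = m ↔ eoc l' = m) (hrm : eoc r = m ↔ eoc r' = m) :
    eoc (.node a l r) = m ↔ eoc (.node a l' r') = m := by
  rcases minimalChain_cases l r with ⟨rfl, rfl⟩ | ⟨b, hlb, hrb⟩ | ⟨c, hlc, hrc⟩
  · obtain rfl := rootLabel?_eq_none.1 hl.symm
    obtain rfl := rootLabel?_eq_none.1 hr.symm
    rfl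
  · rwa [eoc_node_left hlb hrb, eoc_node_left (hl ▸ hlb) (hr ▸ hrb)]
  · rwa [eoc_node_right hlc hrc, eoc_node_right (hl ▸ hlc) (hr ▸ hrc)]

theorem eoc_fill_congr (hs : Increasing s) (hs' : Increasing s') (hk : rootLabel? s = some k)
    (hk' : rootLabel? s' = some k) (hm : m < k) : eoc (C.fill s) = m ↔ eoc (C.fill s') = m := by
  have hroot {C : TreeContext} : rootLabel? (C.fill s) = rootLabel? (C.fill s') :=
    TreeContext.rootLabel?_fill_congr (hk.trans hk'.symm)
  induction C with
  | hole => exact iff_of_false (hm.trans_le (hs.le_eoc hk)).ne' (hm.trans_le (hs'.le_eoc hk')).ne'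
  | left a C r ih => exact eoc_node_congr hroot rfl ih .rfl
  | right a l C ih => exact eoc_node_congr rfl hroot .rfl ih

/-- The secant trees on `S` in which `s` is the whole subtree below one of the nodes. -/
def secantTreesWithSubtree (S : Finset ℕ) (s : BinaryTree ℕ) : Set (BinaryTree ℕ) :=
  {t ∈ secantTrees S | ∃ C : TreeContext, C.fill s = t}

theorem notMem_content_of_fill_mem (ht : C.fill s ∈ secantTrees S) (hx : x ∈ content s) :
    x ∉ C.content := by
  have hnodup := nodup_content ht
  rw [TreeContext.content_fill, Multiset.nodup_add] at hnodup
  exact Multiset.disjoint_right.1 hnodup.2.2 hx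

theorem disjoint_secantTreesWithSubtree (hs : rootLabel? s = some k) (hs' : rootLabel? s' = some k)
    (hne : s ≠ s') : Disjoint (secantTreesWithSubtree S s) (secantTreesWithSubtree S s') := by
  refine Set.disjoint_left.2 ?_
  rintro _ ⟨ht, C, rfl⟩ ⟨ht', C', hC'⟩
  rw [← hC'] at ht'
  exact hne (TreeContext.fill_inj hs hs'
    (notMem_content_of_fill_mem ht (mem_content_of_rootLabel? hs))
    (notMem_content_of_fill_mem ht' (mem_content_of_rootLabel? hs')) hC'.symm).2

theorem fill_mem_secantTrees_congr (hroot : rootLabel? s = rootLabel? s') (hs : Increasing s)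
    (hs' : Increasing s') (hfull : EveryNodeFull s) (hfull' : EveryNodeFull s')
    (hcontent : ∀ A, A + content s = S.val ↔ A + content s' = S'.val) :
    C.fill s ∈ secantTrees S ↔ C.fill s' ∈ secantTrees S' := by
  simp only [secantTrees, Set.mem_ofPred_eq, TreeContext.content_fill, hcontent]
  rw [TreeContext.increasing_fill_congr hroot (iff_of_true hs hs'),
    TreeContext.fullExceptRightmost_fill_congr hroot (iff_of_true hfull hfull')
      (iff_of_false (fun h => h.not_everyNodeFull hfull) fun h => h.not_everyNodeFull hfull')]

theorem ncard_secantTreesWithSubtree_congr (hk : rootLabel? s = some k)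
    (hk' : rootLabel? s' = some k) (hs : Increasing s)
    (hs' : Increasing s') (hfull : EveryNodeFull s) (hfull' : EveryNodeFull s')
    (hcontent : ∀ A, A + content s = S.val ↔ A + content s' = S'.val) (hm : m < k) :
    {t ∈ secantTreesWithSubtree S s | eoc t = m}.ncard =
      {t ∈ secantTreesWithSubtree S' s' | eoc t = m}.ncard := by
  set K : Set TreeContext := {C | C.fill s ∈ secantTrees S ∧ eoc (C.fill s) = m} with hK
  have hK' : K = {C | C.fill s' ∈ secantTrees S' ∧ eoc (C.fill s') = m} := by
    ext C
    exact and_congr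
      (fill_mem_secantTrees_congr (hk.trans hk'.symm) hs hs' hfull hfull' hcontent)
      (eoc_fill_congr hs hs' hk hk' hm)
  have ncard_eq {S : Finset ℕ} {s : BinaryTree ℕ} (hk : rootLabel? s = some k) :
      {t ∈ secantTreesWithSubtree S s | eoc t = m}.ncard =
        {C : TreeContext | C.fill s ∈ secantTrees S ∧ eoc (C.fill s) = m}.ncard := by
    have hmem := mem_content_of_rootLabel? hk
    rw [← Set.InjOn.ncard_image (f := TreeContext.fill s) fun C hC C' hC' h =>
      (TreeContext.fill_inj hk hk (notMem_content_of_fill_mem hC.1 hmem)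
        (notMem_content_of_fill_mem hC'.1 hmem) h).1]
    congr 1
    ext t
    constructor
    · rintro ⟨⟨ht, C, rfl⟩, heoc⟩
      exact ⟨C, ⟨ht, heoc⟩, rfl⟩
    · rintro ⟨C, ⟨ht, heoc⟩, rfl⟩
      exact ⟨⟨ht, C, rfl⟩, heoc⟩
  rw [ncard_eq hk, ncard_eq hk', ← hK, hK']

/-- The tree `t` with a hole in place of the empty right child of its rightmost node. -/
def spine : BinaryTree ℕ → TreeContext
  | .nil => .hole
  | .node a l r => .right a l (spine r)

theorem content_spine : (spine t).content = content t := by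
  induction t with
  | nil => rfl
  | node a l r _ ih => simp [spine, TreeContext.content, ih]

theorem spine_injective : Function.Injective spine := by
  intro t t' h
  induction t generalizing t' with
  | nil => cases t' <;> simp_all [spine]
  | node a l r _ ih =>
    cases t' with
    | nil => simp [spine] at h
    | node a' l' r' =>
      obtain ⟨rfl, rfl, hr⟩ := TreeContext.right.inj h
      rw [ih hr]

theorem rootLabel?_spine_fill (ht : t ≠ .nil) : rootLabel? ((spine t).fill s) = rootLabel? t := by
  cases t with
  | nil => exact absurd rfl ht
  | node a l r => rfl

theorem fullExceptRightmost_spine_fill (ht : FullExceptRightmost t) (hs : FullExceptRightmost s) :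
    FullExceptRightmost ((spine t).fill s) := by
  induction t with
  | nil => exact hs
  | node a l r _ ih =>
    refine ⟨ht.1, ht.2.1, .inr ?_⟩
    rcases ht.2.2 with rfl | hr
    · exact hs
    · exact ih hr

theorem exists_spine_eq (hs : FullExceptRightmost s) (hC : FullExceptRightmost (C.fill s)) :
    ∃ t, spine t = C ∧ (t = .nil ∨ FullExceptRightmost t) := by
  induction C with
  | hole => exact ⟨.nil, rfl, .inl rfl⟩
  | left a C r _ =>
    exact absurd (TreeContext.everyNodeFull_of_fill hC.2.1) hs.not_everyNodeFull
  | right a l C ih =>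
    have hne : C.fill s ≠ .nil := by
      cases C <;> simp [TreeContext.fill, hs.ne_nil]
    obtain ⟨t, rfl, ht⟩ := ih (hC.2.2.resolve_left hne)
    exact ⟨.node a l t, rfl, .inr ⟨hC.1, hC.2.1, ht⟩⟩

theorem increasing_of_spine_fill (h : Increasing ((spine t).fill s)) : Increasing t := by
  induction t with
  | nil => trivial
  | node a l r _ ih =>
    refine ⟨h.1, fun c hc => ?_, h.2.2.1, ih h.2.2.2⟩
    refine h.2.1 c ?_
    rwa [rootLabel?_spine_fill (ne_nil_of_rootLabel? hc)]

/-- The nodes of `spine t` have left children, so that their labels are not maximal in `t`. -/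
theorem increasing_spine_fill (ht : Increasing t) (hfull : FullExceptRightmost t)
    (hs : Increasing s)
    (h : ∀ a ∈ content t, ∀ b ∈ content t, a < b → ∀ c ∈ content s, a < c) :
    Increasing ((spine t).fill s) := by
  induction t with
  | nil => exact hs
  | node a l r _ ih =>
    obtain ⟨hal, har, hl, hr⟩ := increasing_node.1 ht
    have has : ∀ c ∈ content s, a < c := by
      have hb := eoc_mem hfull.1
      exact h a (by simp) (eoc l) (by simp [hb]) (hal _ hb)
    rw [spine, TreeContext.fill, increasing_node]
    refine ⟨hal, fun c hc => ?_, hl, ?_⟩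
    · rw [TreeContext.content_fill, content_spine, Multiset.mem_add] at hc
      exact hc.elim (har c) (has c)
    · rcases hfull.2.2 with rfl | hfull_r
      · exact hs
      · exact ih hr hfull_r fun a ha b hb => h a (by simp [ha]) b (by simp [hb])

theorem eoc_spine_fill (ht : Increasing t) (hfull : FullExceptRightmost t) (hs : Increasing s)
    (hk : rootLabel? s = some k) (hm : m < k) : eoc ((spine t).fill s) = m ↔ eoc t = m := by
  induction t with
  | nil => exact hfull.elim
  | node a l r _ ih =>
    rcases hfull.2.2 with rfl | hr
    · obtain ⟨b, hb⟩ := exists_rootLabel?_eq_some hfull.1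
      rw [spine, spine, TreeContext.fill, TreeContext.fill, eoc_node_left hb (r := .nil) (by simp)]
      rcases lt_or_ge b k with hbk | hkb
      · rw [eoc_node_left hb (by simpa [hk] using hbk)]
      · rw [eoc_node_right (by simpa [hb] using hkb) hk]
        have hml : m < eoc l := hm.trans_le (hkb.trans (ht.2.2.1.le_eoc hb))
        exact iff_of_false (hm.trans_le (hs.le_eoc hk)).ne' hml.ne'
    · exact eoc_node_congr rfl (rootLabel?_spine_fill hr.ne_nil) .rfl (ih ht.2.2.2 hr)

/-- A node with a leaf as its left child and no right child, the shape of the rightmost node. -/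
def hook (k x : ℕ) : BinaryTree ℕ := .node k (leaf x) .nil

/-- A node with two leaves as its children. -/
def fork (k x y : ℕ) : BinaryTree ℕ := .node k (leaf x) (leaf y)

theorem content_hook : content (hook k x) = k ::ₘ {x} := by
  simp [hook]

theorem content_fork : content (fork k x y) = k ::ₘ x ::ₘ {y} := by
  simp [fork]

theorem increasing_hook : Increasing (hook k x) ↔ k < x := by
  simp [hook, Increasing]

theorem increasing_fork : Increasing (fork k x y) ↔ k < x ∧ k < y := by
  simp [fork, Increasing]

theorem fullExceptRightmost_hook : FullExceptRightmost (hook k x) := by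
  simp [hook, FullExceptRightmost, EveryNodeFull]

theorem everyNodeFull_fork : EveryNodeFull (fork k x y) := by
  simp [fork, EveryNodeFull]

theorem Increasing.eq_leaf_of_forall_le (ht : Increasing t) (ha : rootLabel? t = some a)
    (h : ∀ b ∈ content t, b ≤ a) : t = leaf a := by
  have heoc : a = eoc t := (ht.le_eoc ha).antisymm (h _ (eoc_mem (ne_nil_of_rootLabel? ha)))
  rw [heoc] at ha ⊢
  exact ht.eq_leaf_of_rootLabel?_eq_eoc ha

theorem Increasing.eq_nil_or_eq_leaf (ht : Increasing t) (h : ∀ b ∈ content t, b = a) :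
    t = .nil ∨ t = leaf a := by
  refine or_iff_not_imp_left.2 fun hne => ?_
  obtain ⟨b, hb⟩ := exists_rootLabel?_eq_some hne
  obtain rfl := h b (mem_content_of_rootLabel? hb)
  exact ht.eq_leaf_of_forall_le hb fun c hc => (h c hc).le

theorem eq_hook_or_eq_fork (ht : Increasing (.node k l r)) (hnodup : (content (.node k l r)).Nodup)
    (hfull : EveryNodeFull (.node k l r) ∨ FullExceptRightmost (.node k l r))
    (hx : rootLabel? l = some x ∨ rootLabel? r = some x) (hyx : y ≤ x)
    (h : ∀ z ∈ content (.node k l r), k < z → z = x ∨ z = y) :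
    .node k l r = hook k x ∨ .node k l r = fork k x y ∨ .node k l r = fork k y x := by
  obtain ⟨hkl, hkr, hl, hr⟩ := increasing_node.1 ht
  have hdisj := (nodup_content_node.1 hnodup).2.2.2.2
  have hl_mem : ∀ z ∈ content l, z = x ∨ z = y := fun z hz => h z (by simp [hz]) (hkl z hz)
  have hr_mem : ∀ z ∈ content r, z = x ∨ z = y := fun z hz => h z (by simp [hz]) (hkr z hz)
  rcases hx with hx | hx
  · obtain rfl := hl.eq_leaf_of_forall_le hx fun z hz => (hl_mem z hz).elim (·.le) (·.trans_le hyx)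
    have hry : ∀ z ∈ content r, z = y := fun z hz => (hr_mem z hz).resolve_left <| by
      rintro rfl
      exact Multiset.disjoint_left.1 hdisj (mem_content_of_rootLabel? hx) hz
    rcases hr.eq_nil_or_eq_leaf hry with rfl | rfl
    · exact .inl rfl
    · exact .inr (.inl rfl)
  · obtain rfl := hr.eq_leaf_of_forall_le hx fun z hz => (hr_mem z hz).elim (·.le) (·.trans_le hyx)
    have hly : ∀ z ∈ content l, z = y := fun z hz => (hl_mem z hz).resolve_left <| by
      rintro rfl
      exact Multiset.disjoint_left.1 hdisj hz (mem_content_of_rootLabel? hx)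
    rcases hl.eq_nil_or_eq_leaf hly with rfl | rfl
    · simp [EveryNodeFull, FullExceptRightmost] at hfull
    · exact .inr (.inr rfl)

theorem parent?_eq_of_fill_mem (ht : C.fill (.node k l r) ∈ secantTrees S)
    (hx : rootLabel? l = some x ∨ rootLabel? r = some x) :
    parent? x (C.fill (.node k l r)) = some k := by
  have hkids := TreeContext.increasing_of_fill ht.2.1
  have hkx : k < x := hx.elim (hkids.1 x) (hkids.2.1 x)
  have hmem : x ∈ content (.node k l r) := mem_content_node.2 <| .inr <|
    hx.imp mem_content_of_rootLabel? mem_content_of_rootLabel?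
  rw [TreeContext.parent?_fill (notMem_content_of_fill_mem ht hmem) (by simpa using hkx.ne),
    parent?, if_pos hx]

theorem exists_fill_hook_or_fork (ht : t ∈ secantTrees S) (hk : parent? x t = some k) (hyx : y ≤ x)
    (hS : ∀ z ∈ S, k < z → z = x ∨ z = y) :
    ∃ C : TreeContext, C.fill (hook k x) = t ∨ C.fill (fork k x y) = t ∨
      C.fill (fork k y x) = t := by
  obtain ⟨C, l, r, rfl, hx⟩ := TreeContext.exists_fill_of_parent? hk
  have hnodup := nodup_content ht
  rw [TreeContext.content_fill, Multiset.nodup_add] at hnodup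
  have hmem : ∀ z ∈ content (.node k l r), z ∈ S := fun z hz => by
    rw [← mem_content_iff ht, TreeContext.content_fill, Multiset.mem_add]
    exact .inr hz
  refine ⟨C, ?_⟩
  rcases eq_hook_or_eq_fork (TreeContext.increasing_of_fill ht.2.1) hnodup.2.1
    (TreeContext.everyNodeFull_or_fullExceptRightmost_of_fill ht.2.2) hx hyx
    fun z hz => hS z (hmem z hz) with h | h | h
  · exact .inl (h ▸ rfl)
  · exact .inr (.inl (h ▸ rfl))
  · exact .inr (.inr (h ▸ rfl))

theorem sep_parent?_eq_union (hyx : y ≤ x) (hS : ∀ z ∈ S, k < z → z = x ∨ z = y) :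
    {t ∈ secantTrees S | parent? x t = some k} = secantTreesWithSubtree S (hook k x) ∪
      (secantTreesWithSubtree S (fork k x y) ∪ secantTreesWithSubtree S (fork k y x)) := by
  refine Set.Subset.antisymm (fun t ⟨ht, hk⟩ => ?_) ?_
  · obtain ⟨C, hC | hC | hC⟩ := exists_fill_hook_or_fork ht hk hyx hS
    · exact .inl ⟨ht, C, hC⟩
    · exact .inr (.inl ⟨ht, C, hC⟩)
    · exact .inr (.inr ⟨ht, C, hC⟩)
  · rintro _ (⟨ht, C, rfl⟩ | ⟨ht, C, rfl⟩ | ⟨ht, C, rfl⟩)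
    · exact ⟨ht, parent?_eq_of_fill_mem ht (.inl rfl)⟩
    · exact ⟨ht, parent?_eq_of_fill_mem ht (.inl rfl)⟩
    · exact ⟨ht, parent?_eq_of_fill_mem ht (.inr rfl)⟩

theorem secantTreesWithSubtree_fork_self : secantTreesWithSubtree S (fork k x x) = ∅ := by
  refine Set.eq_empty_of_forall_notMem ?_
  rintro _ ⟨ht, C, rfl⟩
  have hnodup := nodup_content ht
  simp [TreeContext.content_fill, content_fork, Multiset.nodup_add] at hnodup

theorem sep_parent?_eq (hS : ∀ z ∈ S, k < z → z = x) :
    {t ∈ secantTrees S | parent? x t = some k} = secantTreesWithSubtree S (hook k x) := by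
  rw [sep_parent?_eq_union le_rfl fun z hz hkz => .inl (hS z hz hkz),
    secantTreesWithSubtree_fork_self, Set.union_self, Set.union_empty]

theorem hook_bijOn (hS : S.Nonempty) (hk : k ∉ S) (hx : ∀ a ∈ insert k S, a < x)
    (hSk : ∀ a ∈ S, ∀ b ∈ S, a < b → a < k) :
    Set.BijOn (fun t => (spine t).fill (hook k x)) (secantTrees S)
      (secantTreesWithSubtree (insert k (insert x S)) (hook k x)) := by
  have hkx : k < x := hx k (S.mem_insert_self k)
  have hxS : x ∉ S := fun h => (hx x (Finset.mem_insert_of_mem h)).false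
  have hcontent (A : Multiset ℕ) :
      A + content (hook k x) = (insert k (insert x S)).val ↔ A = S.val := by
    rw [Finset.insert_val_of_notMem (by simp [hk, hkx.ne]), Finset.insert_val_of_notMem hxS,
      content_hook, Multiset.add_cons, Multiset.cons_inj_right, ← Multiset.cons_zero,
      Multiset.add_cons, Multiset.cons_inj_right, add_zero]
  have hmem {t : BinaryTree ℕ} (ht : t ∈ secantTrees S) :
      (spine t).fill (hook k x) ∈ secantTrees (insert k (insert x S)) := by
    refine ⟨?_, increasing_spine_fill ht.2.1 ht.2.2 (increasing_hook.2 hkx)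
      fun a ha b hb hab c hc => ?_, fullExceptRightmost_spine_fill ht.2.2 fullExceptRightmost_hook⟩
    · rw [TreeContext.content_fill, content_spine, hcontent, ht.1]
    · have hak : a < k := hSk a ((mem_content_iff ht).1 ha) b ((mem_content_iff ht).1 hb) hab
      simp only [content_hook, Multiset.mem_cons, Multiset.mem_singleton] at hc
      rcases hc with rfl | rfl
      exacts [hak, hak.trans hkx]
  have hknot {t : BinaryTree ℕ} (ht : t ∈ secantTrees S) : k ∉ (spine t).content :=
    notMem_content_of_fill_mem (hmem ht) (mem_content_of_rootLabel? rfl)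
  refine ⟨fun t ht => ⟨hmem ht, spine t, rfl⟩, fun t ht t' ht' h => ?_, ?_⟩
  · exact spine_injective (TreeContext.fill_inj rfl rfl (hknot ht) (hknot ht') h).1
  · rintro _ ⟨ht, C, rfl⟩
    obtain ⟨t, rfl, hfull⟩ := exists_spine_eq fullExceptRightmost_hook ht.2.2
    have htS : content t = S.val := by
      rw [← hcontent, ← content_spine, ← TreeContext.content_fill, ht.1]
    have hne : t ≠ .nil := by
      rintro rfl
      exact hS.ne_empty (Finset.val_eq_zero.1 htS.symm)
    exact ⟨t, ⟨htS, increasing_of_spine_fill ht.2.1, hfull.resolve_left hne⟩, rfl⟩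

theorem ncard_secantTreesWithSubtree_hook (hS : S.Nonempty) (hk : k ∉ S)
    (hx : ∀ a ∈ insert k S, a < x) (hSk : ∀ a ∈ S, ∀ b ∈ S, a < b → a < k) (hm : m < k) :
    {t ∈ secantTreesWithSubtree (insert k (insert x S)) (hook k x) | eoc t = m}.ncard =
      {t ∈ secantTrees S | eoc t = m}.ncard :=
  ncard_sep_eq_of_bijOn (hook_bijOn hS hk hx hSk) fun _ ht =>
    eoc_spine_fill ht.2.1 ht.2.2 (increasing_hook.2 (hx k (S.mem_insert_self k))) rfl hm

theorem f_eq_ncard_sep_parent? {N : ℕ} (hN : Even N) :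
    f N m k = {t ∈ {t ∈ secantTrees (.Icc 1 N) | parent? N t = some k} | eoc t = m}.ncard := by
  simp only [f_eq_ncard hN, Set.mem_ofPred_eq, and_assoc, and_comm (a := eoc _ = _)]

theorem f_last_eq (hM : Even M) (hM1 : 1 ≤ M) (hm : m ≤ M) : f (M + 2) m (M + 1) = rowSum M m := by
  have hS : Finset.Icc 1 (M + 2) = insert (M + 1) (insert (M + 2) (.Icc 1 M)) := by
    ext
    simp only [Finset.mem_insert, Finset.mem_Icc]
    omega
  rw [f_eq_ncard_sep_parent? (hM.add even_two), rowSum_eq_ncard hM, hS, sep_parent?_eq]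
  · refine ncard_secantTreesWithSubtree_hook ⟨M, ?_⟩ ?_ ?_ ?_ (by omega) <;> simp <;> omega
  · simp
    omega

theorem ncard_hook_next_to_last (hm : m < M) :
    {t ∈ secantTreesWithSubtree (.Icc 1 (M + 2)) (hook M (M + 2)) | eoc t = m}.ncard =
      {t ∈ secantTrees (.Icc 1 M) | eoc t = m}.ncard := by
  set skip : ℕ → ℕ := fun a => if a < M then a else a + 1 with hskip
  have hmono : StrictMono skip := fun a b hab => by
    simp only [hskip]
    split_ifs <;> omega
  have hskip_eq (a : ℕ) : skip a = m ↔ a = m := by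
    simp only [hskip]
    split_ifs <;> omega
  have himage : (Finset.Icc 1 M).image skip = insert (M + 1) (.Ico 1 M) := by
    have hid : (Finset.Ico 1 M).image skip = .Ico 1 M :=
      (Finset.image_congr fun a ha => if_pos (Finset.mem_Ico.1 ha).2).trans Finset.image_id
    rw [← Finset.Ico_insert_right (by omega), Finset.image_insert, hid, hskip]
    simp
  have hS : Finset.Icc 1 (M + 2) = insert M (insert (M + 2) (insert (M + 1) (.Ico 1 M))) := by
    ext
    simp only [Finset.mem_insert, Finset.mem_Icc, Finset.mem_Ico]
    omega
  rw [hS, ncard_secantTreesWithSubtree_hook (by simp) (by simp) ?_ ?_ hm, ← himage]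
  · exact ncard_sep_eq_of_bijOn (map_bijOn hmono) fun t ht => by
      rw [eoc_map hmono ht.2.2.ne_nil, hskip_eq]
  · simp only [Finset.mem_insert, Finset.mem_Ico]
    omega
  · simp only [Finset.mem_insert, Finset.mem_Ico]
    omega

theorem secantTreesWithSubtree_leaf : secantTreesWithSubtree (.Icc 1 M) (leaf M) =
    secantTrees (.Icc 1 M) := by
  refine Set.Subset.antisymm (Set.sep_subset _ _) fun t ht => ⟨ht, ?_⟩
  have hM : M ∈ content t :=
    (mem_content_iff ht).2 (Finset.mem_Icc.2 ⟨one_le_of_mem_secantTrees ht, le_rfl⟩)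
  obtain ⟨C, l, r, rfl⟩ := TreeContext.exists_fill_of_mem_content hM
  refine ⟨C, ?_⟩
  rw [(TreeContext.increasing_of_fill ht.2.1).eq_leaf_of_forall_le rfl fun b hb => ?_]
  have hb' : b ∈ content (C.fill (.node M l r)) := by
    rw [TreeContext.content_fill, Multiset.mem_add]
    exact .inr hb
  exact (Finset.mem_Icc.1 ((mem_content_iff ht).1 hb')).2

theorem ncard_secantTreesWithSubtree_fork (hkx : k < x) (hky : k < y) (hxy : x ≠ y) (hk : k ∉ S)
    (hx : x ∉ S) (hy : y ∉ S) (hm : m < k) :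
    {t ∈ secantTreesWithSubtree (insert k (insert x (insert y S))) (fork k x y) | eoc t = m}.ncard =
      {t ∈ secantTreesWithSubtree (insert k S) (leaf k) | eoc t = m}.ncard := by
  refine ncard_secantTreesWithSubtree_congr rfl rfl (increasing_fork.2 ⟨hkx, hky⟩)
    (by simp [Increasing]) everyNodeFull_fork (by simp [EveryNodeFull]) (fun A => ?_) hm
  rw [Finset.insert_val_of_notMem (by simp [hkx.ne, hky.ne, hk]),
    Finset.insert_val_of_notMem (by simp [hxy, hx]), Finset.insert_val_of_notMem hy,
    Finset.insert_val_of_notMem hk, content_fork, content_node, content_nil, add_zero,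
    ← Multiset.cons_zero]
  simp only [Multiset.add_cons, Multiset.cons_inj_right, add_zero]

theorem ncard_fork_next_to_last (hm : m < M)
    (hxy : (x = M + 1 ∧ y = M + 2) ∨ (x = M + 2 ∧ y = M + 1)) :
    {t ∈ secantTreesWithSubtree (.Icc 1 (M + 2)) (fork M x y) | eoc t = m}.ncard =
      {t ∈ secantTrees (.Icc 1 M) | eoc t = m}.ncard := by
  have hS : Finset.Icc 1 (M + 2) = insert M (insert x (insert y (.Ico 1 M))) := by
    ext
    simp only [Finset.mem_insert, Finset.mem_Icc, Finset.mem_Ico]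
    omega
  rw [← secantTreesWithSubtree_leaf, hS, ← Finset.Ico_insert_right (by omega)]
  refine ncard_secantTreesWithSubtree_fork (by omega) (by omega) (by omega) ?_ ?_ ?_ hm <;>
    rw [Finset.mem_Ico] <;> omega

theorem f_next_to_last_eq (hM : Even M) (hm : m < M) : f (M + 2) m M = 3 * rowSum M m := by
  have hS : ∀ z ∈ Finset.Icc 1 (M + 2), M < z → z = M + 2 ∨ z = M + 1 := fun z hz hMz => by
    rw [Finset.mem_Icc] at hz
    omega
  have hfin (s : BinaryTree ℕ) :
      {t ∈ secantTreesWithSubtree (.Icc 1 (M + 2)) s | eoc t = m}.Finite :=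
    (finite_secantTrees (hM.add even_two)).subset fun _ ht => ht.1.1
  have hsep (A B : Set (BinaryTree ℕ)) :
      {t ∈ A ∪ B | eoc t = m} = {t ∈ A | eoc t = m} ∪ {t ∈ B | eoc t = m} := Set.sep_union
  have hdisj {s s' : BinaryTree ℕ} (hs : rootLabel? s = some M) (hs' : rootLabel? s' = some M)
      (hne : s ≠ s') : Disjoint {t ∈ secantTreesWithSubtree (.Icc 1 (M + 2)) s | eoc t = m}
        {t ∈ secantTreesWithSubtree (.Icc 1 (M + 2)) s' | eoc t = m} :=
    (disjoint_secantTreesWithSubtree hs hs' hne).mono (Set.sep_subset _ _) (Set.sep_subset _ _)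
  rw [f_eq_ncard_sep_parent? (hM.add even_two), rowSum_eq_ncard hM,
    sep_parent?_eq_union (by omega) hS, hsep, hsep,
    Set.ncard_union_eq _ (hfin _) ((hfin _).union (hfin _)),
    Set.ncard_union_eq _ (hfin _) (hfin _), ncard_hook_next_to_last hm,
    ncard_fork_next_to_last hm (.inr ⟨rfl, rfl⟩), ncard_fork_next_to_last hm (.inl ⟨rfl, rfl⟩)]
  · ring
  · exact hdisj rfl rfl (by simp [fork])
  · exact (hdisj rfl rfl (by simp [hook, fork])).union_right
      (hdisj rfl rfl (by simp [hook, fork]))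

end LastColumns

end SecantTree

theorem theorem1p2 (n : ℕ) (hn : 2 ≤ n) :
    (∀ k : ℕ, 3 ≤ k → k ≤ 2 * n - 1 →
      SecantTree.f (2 * n) 2 k = SecantTree.colSum (2 * n - 2) (k - 2) ∧
      SecantTree.colSum (2 * n - 2) (k - 2) = SecantTree.rowSum (2 * n - 2) (k - 1)) ∧
    (∀ k : ℕ, 4 ≤ k → k ≤ 2 * n - 1 →
      SecantTree.f (2 * n) 3 k = 3 * SecantTree.f (2 * n) 2 k) ∧
    (∀ m : ℕ, 2 ≤ m → m ≤ 2 * n - 2 →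
      SecantTree.f (2 * n) m (2 * n - 1) = SecantTree.rowSum (2 * n - 2) m ∧
      SecantTree.rowSum (2 * n - 2) m = SecantTree.colSum (2 * n - 2) (m - 1)) ∧
    (∀ m : ℕ, 2 ≤ m → m ≤ 2 * n - 3 →
      SecantTree.f (2 * n) m (2 * n - 2) = 3 * SecantTree.f (2 * n) m (2 * n - 1)) := by
  obtain ⟨M, hM⟩ : ∃ M, 2 * n = M + 2 := ⟨2 * n - 2, by omega⟩
  have hM2 : 2 ≤ M := by omega
  have hE : Even M := ⟨n - 1, by omega⟩
  rw [hM, show M + 2 - 2 = M by omega, show M + 2 - 1 = M + 1 by omega]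
  refine ⟨fun k hk _ => ?_, fun k hk _ => SecantTree.f_three_eq hE hM2 hk,
    fun m hm hm' => ?_, fun m _ hm' => ?_⟩
  · obtain ⟨j, rfl⟩ : ∃ j, k = j + 2 := ⟨k - 2, by omega⟩
    exact ⟨SecantTree.f_two_eq_colSum hE hM2,
      (SecantTree.rowSum_succ_eq_colSum hE (by omega)).symm⟩
  · obtain ⟨j, rfl⟩ : ∃ j, m = j + 1 := ⟨m - 1, by omega⟩
    exact ⟨SecantTree.f_last_eq hE (by omega) hm',
      SecantTree.rowSum_succ_eq_colSum hE (by omega)⟩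
  · rw [SecantTree.f_next_to_last_eq hE (by omega), SecantTree.f_last_eq hE (by omega) (by omega)]
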